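/- Let $n\ge 2$ and $\frac{3n-2}{2n-1}<p\le 2-\frac1n$. There is a number $\gamma_0=\gamma_0(n,p)$ with $$\frac{2-p}{2}\le\gamma_0<\frac{(p-1)n}{n-1}\le 1$$ such that for every $\Lambda>0$ there are a constant $C=C(n,p,\Lambda)>0$ and, for every $\varepsilon>0$, a constant $C_\varepsilon=C_\varepsilon(n,p,\Lambda,\varepsilon)>0$ for which the following holds. Let $A:\mathbb R^n\times\mathbb R^n\to\mathbb R^n$ be a Carathéodory map ($A(\cdot,\xi)$ is measurable for every $\xi$, and $A(x,\cdot)$ is continuous for a.e. $x$) such that for a.e. $x\in\mathbb R^n$: $|A(x,\xi)|\le\Lambda|\xi|^{p-1}$ for all $\xi\in\mathbb R^n$, and, for all $\xi\in\mathbb R^n\setminus\{0\}$, $A(x,\cdot)$ is differentiable at $\xi$ with $$|D_\xi A(x,\xi)|\le\Lambda|\xi|^{p-2},\qquad \langle D_\xi A(x,\xi)\eta,\eta\rangle\ge\Lambda^{-1}|\eta|^2|\xi|^{p-2}\quad\text{for all }\eta\in\mathbb R^n .$$ Let $\Omega\subset\mathbb R^n$ be bounded and open, let $\mu$ be a bounded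 signed Radon measure, and let $u\in W^{1,p}_{loc}(\Omega)$ satisfy $-\operatorname{div}(A(x,\nabla u))=\mu$ in $\Omega$ in the sense of distributions. Let $R>0$ and let $B_{2R}=B_{2R}(x_0)$ be a ball with $\overline{B_{2R}}\subset\Omega$. Let $w\in u+W^{1,p}_0(B_{2R})$ be a solution (in the sense of distributions) of $$-\operatorname{div}(A(x,\nabla w))=0\ \text{ in }B_{2R},\qquad w=u\ \text{ on }\partial B_{2R}.$$ Then $$\left(\fint_{B_{2R}}|\nabla u-\nabla w|^{\gamma_0}dx\right)^{\frac1{\gamma_0}}\le C\left[\frac{|\mu|(B_{2R})}{R^{n-1}}\right]^{\frac1{p-1}}+C\,\frac{|\mu|(B_{2R})}{R^{n-1}}\left(\fint_{B_{2R}}|\nabla u|^{\gamma_0}dx\right)^{\frac{2-p}{\gamma_0}},$$ and, for every $\varepsilon>0$, $$\left(\fint_{B_{2R}}|\nabla u-\nabla w|^{\gamma_0}dx\right)^{\frac1{\gamma_0}}\le C_\varepsilon\left[\frac{|\mu|(B_{2R})}{R^{n-1}}\right]^{\frac1{p-1}}+\varepsilon\left(\fint_{B_{2R}}|\nabla u|^{\gamma_0}dx\right)^{\frac1{\gamma_0}}.$$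 -/

import Mathlib

open MeasureTheory Filter Topology
open scoped ContDiff ENNReal RealInnerProductSpace

noncomputable section

namespace SingularMeasureData

/-- The Euclidean space `ℝⁿ`. -/
abbrev Rn (n : ℕ) : Type := EuclideanSpace ℝ (Fin n)

/-- `φ ∈ C_c^∞(U)`. -/
def IsTestFunction {n : ℕ} (U : Set (Rn n)) (φ : Rn n → ℝ) : Prop :=
  ContDiff ℝ ∞ φ ∧ HasCompactSupport φ ∧ tsupport φ ⊆ U

/-- `Du` is the weak (distributional) gradient of `u` in the open set `U`. -/
def IsWeakGradient {n : ℕ} (U : Set (Rn n)) (u : Rn n → ℝ) (Du : Rn n → Rn n) : Prop :=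
  LocallyIntegrableOn u U ∧ LocallyIntegrableOn Du U ∧
    ∀ φ : Rn n → ℝ, IsTestFunction U φ →
      ∫ x in U, u x • gradient φ x = -∫ x in U, φ x • Du x

/-- `u ∈ W^{1,p}(U)`, with weak gradient `Du`. -/
def MemW1p {n : ℕ} (p : ℝ) (U : Set (Rn n)) (u : Rn n → ℝ) (Du : Rn n → Rn n) : Prop :=
  IsWeakGradient U u Du ∧
    MemLp u (ENNReal.ofReal p) (volume.restrict U) ∧
    MemLp Du (ENNReal.ofReal p) (volume.restrict U)

/-- `u ∈ W^{1,p}_loc(U)`, with weak gradient `Du`. -/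
def MemW1pLoc {n : ℕ} (p : ℝ) (U : Set (Rn n)) (u : Rn n → ℝ) (Du : Rn n → Rn n) : Prop :=
  IsWeakGradient U u Du ∧
    ∀ K : Set (Rn n), IsCompact K → K ⊆ U →
      MemLp u (ENNReal.ofReal p) (volume.restrict K) ∧
      MemLp Du (ENNReal.ofReal p) (volume.restrict K)

/-- `u ∈ W^{1,p}_0(U)`, with weak gradient `Du`: `u` is in the closure of `C_c^∞(U)` in
`W^{1,p}(U)`. -/
def MemW1pZero {n : ℕ} (p : ℝ) (U : Set (Rn n)) (u : Rn n → ℝ) (Du : Rn n → Rn n) : Prop :=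
  MemW1p p U u Du ∧
    ∃ φ : ℕ → Rn n → ℝ, (∀ k, IsTestFunction U (φ k)) ∧
      Tendsto (fun k => eLpNorm (fun x => u x - φ k x) (ENNReal.ofReal p) (volume.restrict U))
        atTop (𝓝 0) ∧
      Tendsto (fun k => eLpNorm (fun x => Du x - gradient (φ k) x) (ENNReal.ofReal p)
        (volume.restrict U)) atTop (𝓝 0)

/-- The structure conditions on the nonlinearity `A : ℝⁿ × ℝⁿ → ℝⁿ`: it is a Carathéodory map,
differentiable in `ξ ≠ 0`, with the growth and ellipticity conditions of order `p` and constant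
`Λ`.  (For `p < 2` the factor `|ξ|^{p-2}` is infinite at `ξ = 0`, so the conditions on `D_ξ A` are
conditions at `ξ ≠ 0`.) -/
structure IsNonlinearity {n : ℕ} (p Λ : ℝ) (A : Rn n → Rn n → Rn n) : Prop where
  measurable : ∀ ξ, AEMeasurable (fun x => A x ξ) volume
  continuous : ∀ᵐ x, Continuous (A x)
  growth : ∀ᵐ x, ∀ ξ, ‖A x ξ‖ ≤ Λ * ‖ξ‖ ^ (p - 1)
  differentiable : ∀ᵐ x, ∀ ξ, ξ ≠ 0 → DifferentiableAt ℝ (A x) ξ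
  growth_deriv : ∀ᵐ x, ∀ ξ, ξ ≠ 0 → ‖fderiv ℝ (A x) ξ‖ ≤ Λ * ‖ξ‖ ^ (p - 2)
  elliptic : ∀ᵐ x, ∀ ξ, ξ ≠ 0 → ∀ η,
    Λ⁻¹ * ‖η‖ ^ 2 * ‖ξ‖ ^ (p - 2) ≤ ⟪fderiv ℝ (A x) ξ η, η⟫

/-- `∫ φ dμ` for a bounded signed measure `μ = μ⁺ - μ⁻`. -/
def signedIntegral {n : ℕ} (μ : SignedMeasure (Rn n)) (φ : Rn n → ℝ) : ℝ :=
  (∫ x, φ x ∂μ.toJordanDecomposition.posPart) - ∫ x, φ x ∂μ.toJordanDecomposition.negPart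

/-- A function with gradient `Du` solves `-div A(x, ∇u) = μ` in `U` in the sense of
distributions.  Only the restriction of `μ` to `U` matters here. -/
def SolvesIn {n : ℕ} (A : Rn n → Rn n → Rn n) (U : Set (Rn n)) (Du : Rn n → Rn n)
    (μ : SignedMeasure (Rn n)) : Prop :=
  ∀ φ : Rn n → ℝ, IsTestFunction U φ →
    ∫ x in U, ⟪A x (Du x), gradient φ x⟫ = signedIntegral μ φ

/-- `(w, Dw)` is the solution `w ∈ u + W^{1,p}_0(U)` of `-div A(x, ∇w) = 0` in `U`, `w = u` on
`∂U`. -/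
def IsHomogeneousReplacement {n : ℕ} (p : ℝ) (A : Rn n → Rn n → Rn n) (U : Set (Rn n))
    (u : Rn n → ℝ) (Du : Rn n → Rn n) (w : Rn n → ℝ) (Dw : Rn n → Rn n) : Prop :=
  MemW1pZero p U (fun x => w x - u x) (fun x => Dw x - Du x) ∧ SolvesIn A U Dw 0

end SingularMeasureData

end

/-! Take `γ₀ = 2 - p`. Write B for the ball, M = |μ|(B)/R^(n-1), Q for the average of |Du|^(2-p), v
= w - u, and g = ⟨A(x,Dw) - A(x,Du), Dw - Du⟩. The estimate is proved at a level h with M ≤ h^(p-1)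
and MQ ≤ h, in the form avg |Dv|^(2-p) ≤ C h^(2-p); the choice h ≈ M^(1/(p-1)) + MQ then gives the
first inequality, and Young's inequality gives the second.

Only bounded functions of v can be tested against a measure. Put H = Rh and W = (1 + (v/H)²)^(1/2).
For ξ > 1 the weight W^(-ξ) is the derivative of a bounded function of v/H, so testing the
difference of the two equations gives avg g W^(-ξ) ≲ hM. Ellipticity gives |Dv| ≲ g^(1/p) +
g^(1/2)|Du|^((2-p)/2). Sobolev's inequality in W^{1,1} for W^(1-ξ/2) - 1 bounds (avg W^m)^(1-1/n),
with m = (1-ξ/2)n/(n-1), by h⁻¹ avg W^(-ξ/2)|Dv| plus a constant.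

Now ξ is fixed by m = ξ(2-p)/(2(p-1)). With this m, Hölder's inequality bounds avg W^(-ξ/2)|Dv| by
the tested quantity, avg W^m and Q, with total power 1-1/p of avg W^m. As p < n, this power is
absorbed and avg W^m is bounded by a constant. The same m lets Hölder remove the weight and bound
avg g^((2-p)/p), hence avg |Dv|^(2-p). The requirement ξ > 1 is exactly p > (3n-2)/(2n-1), which is
also what makes 2-p < (p-1)n/(n-1).

The absorption is `exists_integral_rpow_le`, the Sobolev step `exists_average_weight_rpow_le`, and
their combination `exists_average_norm_sub_rpow_le`. -/

namespace SingularMeasureData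

/-! ### Strong monotonicity and its pointwise consequence -/

/-- A map whose derivative has quadratic form at least `c` along the punctured segment. -/
theorem mul_le_inner_of_le_inner_fderiv {E : Type*} [NormedAddCommGroup E]
    [InnerProductSpace ℝ E] {F : E → E} (hF : Continuous F)
    (hd : ∀ ξ, ξ ≠ 0 → DifferentiableAt ℝ F ξ) {ξ η : E} {c : ℝ}
    (hc : ∀ t ∈ Set.Icc (0 : ℝ) 1, η + t • (ξ - η) ≠ 0 →
      c ≤ ⟪fderiv ℝ F (η + t • (ξ - η)) (ξ - η), ξ - η⟫) (hne : ξ ≠ η) :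
    c ≤ ⟪F ξ - F η, ξ - η⟫ := by
  set ζ : ℝ → E := fun t => η + t • (ξ - η) with hζ
  set ψ : ℝ → ℝ := fun t => ⟪F (ζ t), ξ - η⟫ with hψ
  have hζd : ∀ t, HasDerivAt ζ (ξ - η) t := fun t => by
    have h := ((hasDerivAt_id t).smul_const (ξ - η)).const_add η
    rwa [one_smul] at h
  have hζc : Continuous ζ := by fun_prop
  have hψc : Continuous ψ := (hF.comp hζc).inner continuous_const
  have hψd : ∀ t, ζ t ≠ 0 → HasDerivAt ψ ⟪fderiv ℝ F (ζ t) (ξ - η), ξ - η⟫ t := fun t ht => by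
    have h1 : HasDerivAt (fun t => F (ζ t)) (fderiv ℝ F (ζ t) (ξ - η)) t :=
      (hd _ ht).hasFDerivAt.comp_hasDerivAt t (hζd t)
    simpa using h1.inner ℝ (hasDerivAt_const t (ξ - η))
  have key : ∀ a b : ℝ, 0 ≤ a → a ≤ b → b ≤ 1 → (∀ t ∈ Set.Ioo a b, ζ t ≠ 0) →
      c * (b - a) ≤ ψ b - ψ a := by
    intro a b ha hab hb hz
    refine (convex_Icc a b).mul_sub_le_image_sub_of_le_deriv hψc.continuousOn ?_ ?_ a
      (Set.left_mem_Icc.2 hab) b (Set.right_mem_Icc.2 hab) hab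
    · rw [interior_Icc]
      exact fun t ht => (hψd t (hz t ht)).differentiableAt.differentiableWithinAt
    · rw [interior_Icc]
      intro t ht
      rw [(hψd t (hz t ht)).deriv]
      exact hc t ⟨ha.trans ht.1.le, ht.2.le.trans hb⟩ (hz t ht)
  have hψ01 : ψ 1 - ψ 0 = ⟪F ξ - F η, ξ - η⟫ := by
    simp [hψ, hζ, inner_sub_left]
  rw [← hψ01]
  -- As `ξ ≠ η`, the segment meets the origin, where `F` need not be differentiable, at most once.
  -- Continuity of `F` lets the mean value estimates on the two sides be added.
  by_cases hz : ∃ t ∈ Set.Ioo (0 : ℝ) 1, ζ t = 0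
  · obtain ⟨t, ht, hzt⟩ := hz
    have huniq : ∀ s, ζ s = 0 → s = t := by
      intro s hs
      have : (s - t) • (ξ - η) = 0 := by
        have h := congrArg₂ (· - ·) hs hzt
        simpa [hζ, sub_smul] using h
      rcases smul_eq_zero.1 this with h | h
      · linarith
      · exact absurd (sub_eq_zero.1 h) hne
    have h1 := key 0 t le_rfl ht.1.le ht.2.le fun s hs h => hs.2.ne (huniq s h)
    have h2 := key t 1 ht.1.le ht.2.le le_rfl fun s hs h => hs.1.ne' (huniq s h)
    linarith
  · push Not at hz
    have := key 0 1 le_rfl zero_le_one le_rfl hz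
    linarith

/-- Every point of the segment has norm at most `‖ξ‖ + ‖η‖`, and `p - 2 ≤ 0`, so the ellipticity
weight along the segment is at least its value at that sum. -/
theorem strong_monotonicity {E : Type*} [NormedAddCommGroup E] [InnerProductSpace ℝ E]
    {F : E → E} {p L : ℝ} (hp : p ≤ 2) (hL : 0 < L) (hF : Continuous F)
    (hd : ∀ ξ, ξ ≠ 0 → DifferentiableAt ℝ F ξ)
    (he : ∀ ξ, ξ ≠ 0 → ∀ η, L⁻¹ * ‖η‖ ^ 2 * ‖ξ‖ ^ (p - 2) ≤ ⟪fderiv ℝ F ξ η, η⟫) (ξ η : E) :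
    L⁻¹ * ‖ξ - η‖ ^ 2 * (‖ξ‖ + ‖η‖) ^ (p - 2) ≤ ⟪F ξ - F η, ξ - η⟫ := by
  rcases eq_or_ne ξ η with rfl | hne
  · simp
  refine mul_le_inner_of_le_inner_fderiv hF hd (fun t ht h0 => le_trans ?_ (he _ h0 _)) hne
  refine mul_le_mul_of_nonneg_left ?_ (by positivity)
  refine Real.rpow_le_rpow_of_nonpos (norm_pos_iff.2 h0) ?_ (by linarith)
  have : η + t • (ξ - η) = t • ξ + (1 - t) • η := by module
  rw [this]
  refine (norm_add_le _ _).trans ?_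
  rw [norm_smul, norm_smul, Real.norm_of_nonneg ht.1, Real.norm_of_nonneg (by linarith [ht.2])]
  nlinarith [norm_nonneg ξ, norm_nonneg η, ht.1, ht.2]

/-- The gradient difference controlled by the monotonicity quantity `g`. -/
theorem le_rpow_add_rpow_of_mul_sq_le {p L a b d g : ℝ} (hp : 1 < p) (hp2 : p < 2) (hL : 0 < L)
    (ha : 0 ≤ a) (hd : 0 ≤ d) (hdab : d ≤ a + b) (hbd : b ≤ a + d) (hg0 : 0 ≤ g)
    (hg : L⁻¹ * d ^ 2 * (a + b) ^ (p - 2) ≤ g) :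
    d ≤ ((3 * L) ^ (1 / p) + (3 * L) ^ (1 / 2 : ℝ)) *
      (g ^ (1 / p) + g ^ (1 / 2 : ℝ) * a ^ ((2 - p) / 2)) := by
  have hA : 0 ≤ (3 * L) ^ (1 / p) := by positivity
  have hB : 0 ≤ (3 * L) ^ (1 / 2 : ℝ) := by positivity
  have hC : 0 ≤ g ^ (1 / p) := by positivity
  have hD : 0 ≤ g ^ (1 / 2 : ℝ) * a ^ ((2 - p) / 2) := by positivity
  rcases hd.eq_or_lt with rfl | hdpos
  · positivity
  have hs : 0 < a + b := lt_of_lt_of_le hdpos hdab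
  have h1 : d ^ 2 ≤ L * g * (a + b) ^ (2 - p) := by
    have h2 : (a + b) ^ (p - 2) * (a + b) ^ (2 - p) = 1 := by
      rw [← Real.rpow_add hs]; simp
    have h3 := mul_le_mul_of_nonneg_left hg (a := L * (a + b) ^ (2 - p)) (by positivity)
    have h4 : L * (a + b) ^ (2 - p) * (L⁻¹ * d ^ 2 * (a + b) ^ (p - 2)) =
        (L * L⁻¹) * d ^ 2 * ((a + b) ^ (p - 2) * (a + b) ^ (2 - p)) := by ring
    rw [h4, h2, mul_inv_cancel₀ hL.ne'] at h3
    linarith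
  have key : ∀ t, 0 < t → a + b ≤ 3 * t → d ^ 2 ≤ 3 * L * g * t ^ (2 - p) := by
    intro t ht hab
    have h5 : (a + b) ^ (2 - p) ≤ 3 * t ^ (2 - p) := by
      calc (a + b) ^ (2 - p) ≤ (3 * t) ^ (2 - p) :=
            Real.rpow_le_rpow hs.le hab (by linarith)
        _ = 3 ^ (2 - p) * t ^ (2 - p) := Real.mul_rpow (by norm_num) ht.le
        _ ≤ 3 * t ^ (2 - p) := by
            gcongr
            calc (3 : ℝ) ^ (2 - p) ≤ 3 ^ (1 : ℝ) :=
                  Real.rpow_le_rpow_of_exponent_le (by norm_num) (by linarith)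
              _ = 3 := Real.rpow_one 3
    nlinarith [mul_le_mul_of_nonneg_left h5 (mul_nonneg hL.le hg0)]
  -- If `d ≤ a` then `a + b ≤ 3a`, which gives the `g ^ (1/2)` term; otherwise `a + b ≤ 3d`, and
  -- dividing by `d ^ (2 - p)` leaves `d ^ p ≤ 3Lg`.
  rcases le_or_gt d a with hda | hda
  · have h6 := key a (hdpos.trans_le hda) (by linarith)
    have h7 : d ≤ (3 * L * g * a ^ (2 - p)) ^ (1 / 2 : ℝ) := by
      rw [← Real.sqrt_eq_rpow]; exact Real.le_sqrt_of_sq_le h6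
    rw [Real.mul_rpow (by positivity) (by positivity), Real.mul_rpow (by positivity) hg0,
      ← Real.rpow_mul ha] at h7
    have h8 : (2 - p) * (1 / 2) = (2 - p) / 2 := by ring
    rw [h8] at h7
    nlinarith [mul_nonneg hA hC, mul_nonneg hA hD, mul_nonneg hB hC]
  · have h6 := key d hdpos (by linarith)
    have h7 : d ^ p ≤ 3 * L * g := by
      have h9 : d ^ 2 = d ^ p * d ^ (2 - p) := by
        rw [← Real.rpow_add hdpos, ← Real.rpow_natCast]; norm_num
      rw [h9] at h6
      exact le_of_mul_le_mul_right h6 (by positivity)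
    have h8 : d ≤ (3 * L * g) ^ (1 / p) := by
      calc d = (d ^ p) ^ (1 / p) := by
            rw [← Real.rpow_mul hd, mul_one_div_cancel (by linarith), Real.rpow_one]
        _ ≤ _ := Real.rpow_le_rpow (by positivity) h7 (by positivity)
    rw [Real.mul_rpow (by positivity) hg0] at h8
    nlinarith [mul_nonneg hA hD, mul_nonneg hB hD, mul_nonneg hB hC]

/-! ### Hölder's inequality with exponents `1/s` and `1/(1-s)` -/

section Holder

variable {α : Type*} [MeasurableSpace α] {ν : Measure α} {f g : α → ℝ} {s : ℝ}

theorem integrable_rpow_mul_rpow (hf : Integrable f ν) (hg : Integrable g ν)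
    (hf0 : ∀ x, 0 ≤ f x) (hg0 : ∀ x, 0 ≤ g x) (hs0 : 0 ≤ s) (hs1 : s ≤ 1) :
    Integrable (fun x => f x ^ s * g x ^ (1 - s)) ν := by
  refine ((hf.const_mul s).add (hg.const_mul (1 - s))).mono'
    ((hf.aemeasurable.pow_const s).mul (hg.aemeasurable.pow_const _)).aestronglyMeasurable ?_
  refine Eventually.of_forall fun x => ?_
  rw [Real.norm_of_nonneg (mul_nonneg (Real.rpow_nonneg (hf0 x) _) (Real.rpow_nonneg (hg0 x) _))]
  exact Real.geom_mean_le_arith_mean2_weighted hs0 (by linarith) (hf0 x) (hg0 x) (by ring)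

theorem integral_rpow_mul_rpow_le (hf : Integrable f ν) (hg : Integrable g ν)
    (hf0 : ∀ x, 0 ≤ f x) (hg0 : ∀ x, 0 ≤ g x) (hs0 : 0 ≤ s) (hs1 : s ≤ 1) :
    ∫ x, f x ^ s * g x ^ (1 - s) ∂ν ≤ (∫ x, f x ∂ν) ^ s * (∫ x, g x ∂ν) ^ (1 - s) := by
  have hs1' : 0 ≤ 1 - s := by linarith
  have h := ENNReal.lintegral_mul_norm_pow_le (μ := ν) hf.aemeasurable.ennreal_ofReal
    hg.aemeasurable.ennreal_ofReal hs0 hs1' (by ring)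
  have hF := integral_nonneg (μ := ν) (f := f) hf0
  have hG := integral_nonneg (μ := ν) (f := g) hg0
  rw [← ofReal_integral_eq_lintegral_ofReal hf (.of_forall hf0),
    ← ofReal_integral_eq_lintegral_ofReal hg (.of_forall hg0),
    ENNReal.ofReal_rpow_of_nonneg hF hs0, ENNReal.ofReal_rpow_of_nonneg hG hs1',
    ← ENNReal.ofReal_mul (by positivity)] at h
  have h2 : ∀ x, ENNReal.ofReal (f x) ^ s * ENNReal.ofReal (g x) ^ (1 - s) =
      ENNReal.ofReal (f x ^ s * g x ^ (1 - s)) := fun x => by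
    rw [ENNReal.ofReal_rpow_of_nonneg (hf0 x) hs0, ENNReal.ofReal_rpow_of_nonneg (hg0 x) hs1',
      ← ENNReal.ofReal_mul (Real.rpow_nonneg (hf0 x) _)]
  simp_rw [h2] at h
  rw [← ofReal_integral_eq_lintegral_ofReal (integrable_rpow_mul_rpow hf hg hf0 hg0 hs0 hs1)
    (.of_forall fun x => mul_nonneg (Real.rpow_nonneg (hf0 x) _) (Real.rpow_nonneg (hg0 x) _))] at h
  exact (ENNReal.ofReal_le_ofReal_iff (by positivity)).1 h

end Holder

/-! ### The absorption argument on a probability space -/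

/-- An `L^{2-p}` bound for `d` from a weighted `L¹` bound for `g` and a Sobolev-type bound for the
weight `W`. -/
theorem exists_integral_rpow_le {p N c : ℝ} (hp : 1 < p) (hp2 : p < 2) (hN : 2 ≤ N)
    (hc : 0 ≤ c) :
    ∃ C : ℝ, 0 ≤ C ∧ ∀ (α : Type) [MeasurableSpace α] (ν : Measure α) [IsProbabilityMeasure ν]
      (g a d W : α → ℝ) (ξ m h M : ℝ), 0 < ξ → m = ξ * (2 - p) / (2 * (p - 1)) → 0 < h → 0 ≤ M →
      (∀ x, 0 ≤ g x) → (∀ x, 0 ≤ a x) → (∀ x, 0 ≤ d x) → (∀ x, 1 ≤ W x) →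
      Integrable (fun x => g x * W x ^ (-ξ)) ν → Integrable (fun x => a x ^ (2 - p)) ν →
      Integrable (fun x => W x ^ m) ν →
      (∀ᵐ x ∂ν, d x ≤ c * (g x ^ (1 / p) + g x ^ (1 / 2 : ℝ) * a x ^ ((2 - p) / 2))) →
      ∫ x, g x * W x ^ (-ξ) ∂ν ≤ c * (h * M) →
      (∫ x, W x ^ m ∂ν) ^ (1 - 1 / N) ≤ c * (h⁻¹ * ∫ x, W x ^ (-ξ / 2) * d x ∂ν) + c →
      M ≤ h ^ (p - 1) → M * ∫ x, a x ^ (2 - p) ∂ν ≤ h →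
      ∫ x, d x ^ (2 - p) ∂ν ≤ C * h ^ (2 - p) := by
  -- `D` is the constant in `Y ^ (1 - 1/N) ≤ D * Y ^ (1 - 1/p)`, where `Y = ∫ W ^ m`; solving for
  -- `Y` gives the bound `E`.
  set D : ℝ := c * (c * (c ^ (1 / p) + c ^ (1 / 2 : ℝ))) + c with hD
  have hD0 : 0 ≤ D := by positivity
  set E : ℝ := D ^ (1 / (1 / p - 1 / N)) with hE
  have hE0 : 0 ≤ E := by positivity
  set θ : ℝ := (2 - p) / p with hθ
  have hp0 : 0 < p := by linarith
  have hθ0 : 0 ≤ θ := div_nonneg (by linarith) hp0.le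
  have hθ1 : θ ≤ 1 := by rw [hθ, div_le_one hp0]; linarith
  refine ⟨c ^ (2 - p) * (c ^ θ * E ^ (1 - θ) + c ^ ((2 - p) / 2) * (E ^ (1 - θ)) ^ (p / 2)),
    by positivity, ?_⟩
  intro α _ ν _ g a d W ξ m h M hξ hm hh hM hg0 ha0 hd0 hW1 hbi hai hWi hd hK hS hM1 hM2
  have hW0 : ∀ x, 0 < W x := fun x => zero_lt_one.trans_le (hW1 x)
  have hb0 : ∀ x, 0 ≤ g x * W x ^ (-ξ) := fun x =>
    mul_nonneg (hg0 x) (Real.rpow_nonneg (hW0 x).le _)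
  have ha0' : ∀ x, 0 ≤ a x ^ (2 - p) := fun x => Real.rpow_nonneg (ha0 x) _
  have hWm0 : ∀ x, 0 ≤ W x ^ m := fun x => Real.rpow_nonneg (hW0 x).le _
  have hm0 : 0 ≤ m := by
    rw [hm]; exact div_nonneg (mul_nonneg hξ.le (by linarith)) (by linarith)
  set K := ∫ x, g x * W x ^ (-ξ) ∂ν with hKdef
  set Q := ∫ x, a x ^ (2 - p) ∂ν with hQdef
  set Y := ∫ x, W x ^ m ∂ν with hYdef
  have hK0 : 0 ≤ K := integral_nonneg hb0
  have hQ0 : 0 ≤ Q := integral_nonneg ha0'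
  -- Having `Y ≥ 1` lets the terms without `Y` be absorbed into `Y ^ (1 - 1/p)`.
  have hY1 : 1 ≤ Y := by
    have : ∫ _, (1 : ℝ) ∂ν ≤ Y :=
      integral_mono (integrable_const _) hWi fun x => Real.one_le_rpow (hW1 x) hm0
    simpa using this
  have hY0 : 0 < Y := by linarith
  have hKh : K ≤ c * h ^ p := by
    refine hK.trans (mul_le_mul_of_nonneg_left ?_ hc)
    calc h * M ≤ h * h ^ (p - 1) := by gcongr
      _ = h ^ p := by rw [← Real.rpow_one_add' hh.le (by linarith)]; congr 1; ring
  have hKp : K ^ (1 / p) ≤ c ^ (1 / p) * h := by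
    calc K ^ (1 / p) ≤ (c * h ^ p) ^ (1 / p) := Real.rpow_le_rpow hK0 hKh (by positivity)
      _ = c ^ (1 / p) * h := by
        rw [Real.mul_rpow hc (by positivity), ← Real.rpow_mul hh.le,
          mul_one_div_cancel hp0.ne', Real.rpow_one]
  have hKQ' : K * Q ≤ c * h ^ (2 : ℝ) := by
    calc K * Q ≤ c * (h * M) * Q := by gcongr
      _ = c * (h * (M * Q)) := by ring
      _ ≤ c * (h * h) := by gcongr
      _ = c * h ^ (2 : ℝ) := by norm_num [pow_two]
  have hKQ : K ^ (1 / 2 : ℝ) * Q ^ (1 / 2 : ℝ) ≤ c ^ (1 / 2 : ℝ) * h := by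
    rw [← Real.mul_rpow hK0 hQ0]
    calc (K * Q) ^ (1 / 2 : ℝ) ≤ (c * h ^ (2 : ℝ)) ^ (1 / 2 : ℝ) :=
          Real.rpow_le_rpow (by positivity) hKQ' (by norm_num)
      _ = c ^ (1 / 2 : ℝ) * h := by
        rw [Real.mul_rpow hc (by positivity), ← Real.rpow_mul hh.le]; norm_num
  -- the weighted integral of `d`
  have hX : ∫ x, W x ^ (-ξ / 2) * d x ∂ν ≤
      c * (K ^ (1 / p) * Y ^ (1 - 1 / p) + K ^ (1 / 2 : ℝ) * Q ^ (1 - 1 / 2 : ℝ)) := by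
    have hs1 : (1 / p) ≤ 1 := by rw [div_le_one hp0]; exact hp.le
    have hs0 : 0 ≤ 1 / p := by positivity
    have i1 := integrable_rpow_mul_rpow hbi hWi hb0 hWm0 hs0 hs1
    have i2 := integrable_rpow_mul_rpow (s := 1 / 2) hbi hai hb0 ha0' (by norm_num) (by norm_num)
    have e1 := integral_rpow_mul_rpow_le hbi hWi hb0 hWm0 hs0 hs1
    have e2 := integral_rpow_mul_rpow_le (s := 1 / 2) hbi hai hb0 ha0' (by norm_num) (by norm_num)
    calc ∫ x, W x ^ (-ξ / 2) * d x ∂ν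
        ≤ ∫ x, c * ((g x * W x ^ (-ξ)) ^ (1 / p) * (W x ^ m) ^ (1 - 1 / p) +
            (g x * W x ^ (-ξ)) ^ (1 / 2 : ℝ) * (a x ^ (2 - p)) ^ (1 - 1 / 2 : ℝ)) ∂ν := by
          refine integral_mono_of_nonneg
            (.of_forall fun x => mul_nonneg (Real.rpow_nonneg (hW0 x).le _) (hd0 x))
            ((i1.add i2).const_mul c) ?_
          filter_upwards [hd] with x hx
          -- This identity of exponents is what dictates `m = ξ(2-p)/(2(p-1))`.
          have f1 : (g x * W x ^ (-ξ)) ^ (1 / p) * (W x ^ m) ^ (1 - 1 / p) =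
              W x ^ (-ξ / 2) * g x ^ (1 / p) := by
            rw [Real.mul_rpow (hg0 x) (Real.rpow_nonneg (hW0 x).le _), ← Real.rpow_mul (hW0 x).le,
              ← Real.rpow_mul (hW0 x).le, mul_assoc, ← Real.rpow_add (hW0 x), mul_comm]
            congr 2
            rw [hm]
            have : p - 1 ≠ 0 := by linarith
            field_simp
            ring
          have f2 : (g x * W x ^ (-ξ)) ^ (1 / 2 : ℝ) * (a x ^ (2 - p)) ^ (1 - 1 / 2 : ℝ) =
              W x ^ (-ξ / 2) * (g x ^ (1 / 2 : ℝ) * a x ^ ((2 - p) / 2)) := by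
            rw [Real.mul_rpow (hg0 x) (Real.rpow_nonneg (hW0 x).le _), ← Real.rpow_mul (hW0 x).le,
              ← Real.rpow_mul (ha0 x)]
            rw [show -ξ * (1 / 2) = -ξ / 2 by ring,
              show (2 - p) * (1 - 1 / 2 : ℝ) = (2 - p) / 2 by ring]
            ring
          rw [f1, f2, ← mul_add, mul_left_comm]
          exact mul_le_mul_of_nonneg_left hx (Real.rpow_nonneg (hW0 x).le _)
      _ ≤ _ := by
          rw [integral_const_mul, integral_add i1 i2]
          gcongr
  have hYb : Y ≤ E := by
    have hpp : 0 ≤ 1 - 1 / p := by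
      rw [sub_nonneg, div_le_one hp0]; exact hp.le
    have hYp : 1 ≤ Y ^ (1 - 1 / p) := Real.one_le_rpow hY1 hpp
    have h1 : Y ^ (1 - 1 / N) ≤ D * Y ^ (1 - 1 / p) := by
      have h2 : h⁻¹ * ∫ x, W x ^ (-ξ / 2) * d x ∂ν ≤
          c * (c ^ (1 / p) + c ^ (1 / 2 : ℝ)) * Y ^ (1 - 1 / p) := by
        have h3 : ∫ x, W x ^ (-ξ / 2) * d x ∂ν ≤
            c * (c ^ (1 / p) * h * Y ^ (1 - 1 / p) + c ^ (1 / 2 : ℝ) * h * Y ^ (1 - 1 / p)) := by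
          refine hX.trans (mul_le_mul_of_nonneg_left (add_le_add (by gcongr) ?_) hc)
          rw [show (1 - 1 / 2 : ℝ) = 1 / 2 by norm_num]
          exact hKQ.trans (le_mul_of_one_le_right (by positivity) hYp)
        rw [inv_mul_le_iff₀ hh]
        linarith
      calc _ ≤ _ := hS
        _ ≤ c * (c * (c ^ (1 / p) + c ^ (1 / 2 : ℝ)) * Y ^ (1 - 1 / p)) + c * Y ^ (1 - 1 / p) := by
          gcongr
          exact le_mul_of_one_le_right hc hYp
        _ = D * Y ^ (1 - 1 / p) := by rw [hD]; ring
    -- Here `p < 2 ≤ N`: the Sobolev power of `Y` beats the power on the right.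
    have hexp : 0 < 1 / p - 1 / N := by
      rw [sub_pos]; exact one_div_lt_one_div_of_lt hp0 (by linarith)
    have h4 : Y ^ (1 / p - 1 / N) ≤ D := by
      have : Y ^ (1 - 1 / N) = Y ^ (1 / p - 1 / N) * Y ^ (1 - 1 / p) := by
        rw [← Real.rpow_add hY0]; congr 1; ring
      rw [this] at h1
      exact le_of_mul_le_mul_right h1 (by linarith)
    calc Y = (Y ^ (1 / p - 1 / N)) ^ (1 / (1 / p - 1 / N)) := by
          rw [← Real.rpow_mul hY0.le, mul_one_div_cancel hexp.ne', Real.rpow_one]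
      _ ≤ E := Real.rpow_le_rpow (by positivity) h4 (by positivity)
  -- the `L^θ` bound of `g`
  have hgθ : ∀ x, (g x * W x ^ (-ξ)) ^ θ * (W x ^ m) ^ (1 - θ) = g x ^ θ := fun x => by
    rw [Real.mul_rpow (hg0 x) (Real.rpow_nonneg (hW0 x).le _), ← Real.rpow_mul (hW0 x).le,
      ← Real.rpow_mul (hW0 x).le, mul_assoc, ← Real.rpow_add (hW0 x)]
    -- The same `m` makes the weight cancel at the exponent `θ = (2-p)/p`, leaving an unweighted
    -- integral of `g ^ θ`.
    have : -ξ * θ + m * (1 - θ) = 0 := by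
      rw [hm, hθ]
      have : p - 1 ≠ 0 := by linarith
      field_simp
      ring
    rw [this, Real.rpow_zero, mul_one]
  have hgi : Integrable (fun x => g x ^ θ) ν := by
    have := integrable_rpow_mul_rpow hbi hWi hb0 hWm0 hθ0 hθ1
    simpa only [hgθ] using this
  have hgθ0 : ∀ x, 0 ≤ g x ^ θ := fun x => Real.rpow_nonneg (hg0 x) _
  set J := ∫ x, g x ^ θ ∂ν with hJ
  have hJ0 : 0 ≤ J := integral_nonneg hgθ0
  have hJb : J ≤ K ^ θ * E ^ (1 - θ) := by
    have h1 := integral_rpow_mul_rpow_le hbi hWi hb0 hWm0 hθ0 hθ1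
    simp only [hgθ] at h1
    refine h1.trans ?_
    have : 0 ≤ 1 - θ := by linarith
    gcongr
  have hp2' : 0 ≤ 2 - p := by linarith
  have hJ1 : J ≤ c ^ θ * E ^ (1 - θ) * h ^ (2 - p) := by
    calc J ≤ (c * h ^ p) ^ θ * E ^ (1 - θ) := hJb.trans (by gcongr)
      _ = _ := by
        rw [Real.mul_rpow hc (by positivity), ← Real.rpow_mul hh.le,
          show p * θ = 2 - p by rw [hθ]; field_simp]
        ring
  have hJ2 : J ^ (p / 2) * Q ^ ((2 - p) / 2) ≤
      c ^ ((2 - p) / 2) * (E ^ (1 - θ)) ^ (p / 2) * h ^ (2 - p) := by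
    calc J ^ (p / 2) * Q ^ ((2 - p) / 2)
        ≤ (K ^ θ * E ^ (1 - θ)) ^ (p / 2) * Q ^ ((2 - p) / 2) := by gcongr
      _ = (K * Q) ^ ((2 - p) / 2) * (E ^ (1 - θ)) ^ (p / 2) := by
        rw [Real.mul_rpow (by positivity) (by positivity), ← Real.rpow_mul hK0,
          Real.mul_rpow hK0 hQ0, show θ * (p / 2) = (2 - p) / 2 by rw [hθ]; field_simp]
        ring
      _ ≤ (c * h ^ (2 : ℝ)) ^ ((2 - p) / 2) * (E ^ (1 - θ)) ^ (p / 2) := by gcongr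
      _ = _ := by
        rw [Real.mul_rpow hc (by positivity), ← Real.rpow_mul hh.le,
          show 2 * ((2 - p) / 2) = 2 - p by ring]
        ring
  have hq0 : 0 ≤ p / 2 := by positivity
  have hq1 : p / 2 ≤ 1 := by linarith
  have i3 := integrable_rpow_mul_rpow hgi hai hgθ0 ha0' hq0 hq1
  have e3 := integral_rpow_mul_rpow_le hgi hai hgθ0 ha0' hq0 hq1
  have hexp : 1 - p / 2 = (2 - p) / 2 := by ring
  calc ∫ x, d x ^ (2 - p) ∂ν
      ≤ ∫ x, c ^ (2 - p) * (g x ^ θ + (g x ^ θ) ^ (p / 2) * (a x ^ (2 - p)) ^ (1 - p / 2)) ∂ν := by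
        refine integral_mono_of_nonneg (.of_forall fun x => Real.rpow_nonneg (hd0 x) _)
          ((hgi.add i3).const_mul _) ?_
        filter_upwards [hd] with x hx
        have f1 : g x ^ θ = (g x ^ (1 / p)) ^ (2 - p) := by
          rw [← Real.rpow_mul (hg0 x)]; congr 1; rw [hθ]; ring
        have f2 : (g x ^ θ) ^ (p / 2) * (a x ^ (2 - p)) ^ (1 - p / 2) =
            (g x ^ (1 / 2 : ℝ) * a x ^ ((2 - p) / 2)) ^ (2 - p) := by
          rw [Real.mul_rpow (Real.rpow_nonneg (hg0 x) _) (Real.rpow_nonneg (ha0 x) _),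
            ← Real.rpow_mul (hg0 x), ← Real.rpow_mul (hg0 x), ← Real.rpow_mul (ha0 x),
            ← Real.rpow_mul (ha0 x), hexp]
          congr 2
          · rw [hθ]; field_simp
          · ring
        have hu : 0 ≤ g x ^ (1 / p) := Real.rpow_nonneg (hg0 x) _
        have hv : 0 ≤ g x ^ (1 / 2 : ℝ) * a x ^ ((2 - p) / 2) :=
          mul_nonneg (Real.rpow_nonneg (hg0 x) _) (Real.rpow_nonneg (ha0 x) _)
        simp only [f2]
        rw [f1]
        calc d x ^ (2 - p) ≤ (c * (g x ^ (1 / p) + g x ^ (1 / 2 : ℝ) * a x ^ ((2 - p) / 2))) ^ (2 - p) :=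
              Real.rpow_le_rpow (hd0 x) hx hp2'
          _ = c ^ (2 - p) * (g x ^ (1 / p) + g x ^ (1 / 2 : ℝ) * a x ^ ((2 - p) / 2)) ^ (2 - p) :=
              Real.mul_rpow hc (by positivity)
          _ ≤ _ := by
              gcongr
              exact Real.rpow_add_le_add_rpow hu hv hp2' (by linarith)
    _ ≤ c ^ (2 - p) * (J + J ^ (p / 2) * Q ^ ((2 - p) / 2)) := by
        rw [integral_const_mul, integral_add hgi i3]
        gcongr
        rw [hexp] at e3 ⊢
        exact e3
    _ ≤ c ^ (2 - p) * (c ^ θ * E ^ (1 - θ) * h ^ (2 - p) +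
          c ^ ((2 - p) / 2) * (E ^ (1 - θ)) ^ (p / 2) * h ^ (2 - p)) := by gcongr
    _ = _ := by ring

/-! ### Measurability and convergence in Lebesgue spaces -/

/-- The superposition of a Carathéodory map with a measurable function is measurable. -/
theorem aemeasurable_superposition {α E : Type*} [MeasurableSpace α] {μ : Measure α}
    [NormedAddCommGroup E] [MeasurableSpace E] [BorelSpace E] [SecondCountableTopology E]
    {A : α → E → E} (hm : ∀ ξ, AEMeasurable (fun x => A x ξ) μ)
    (hc : ∀ᵐ x ∂μ, Continuous (A x)) {f : α → E} (hf : AEStronglyMeasurable f μ) :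
    AEMeasurable (fun x => A x (f x)) μ := by
  set s := hf.stronglyMeasurable_mk.approx with hs
  have key : ∀ j, AEMeasurable (fun x => A x (s j x)) μ := by
    intro j
    have : (fun x => A x (s j x)) = fun x =>
        ∑ ξ ∈ (s j).range, (s j ⁻¹' {ξ}).indicator (fun x => A x ξ) x := by
      funext x
      rw [Finset.sum_eq_single (s j x)]
      · simp
      · intro ξ _ hξ
        exact Set.indicator_of_notMem (fun h => hξ (by simpa using h.symm)) _
      · intro h
        exact absurd ((s j).mem_range_self x) h
    rw [this]
    exact Finset.aemeasurable_fun_sum _ fun ξ _ => (hm ξ).indicator ((s j).measurableSet_fiber ξ)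
  refine aemeasurable_of_tendsto_metrizable_ae atTop key ?_
  filter_upwards [hc, hf.ae_eq_mk] with x hx hfx
  rw [hfx]
  exact (hx.tendsto _).comp (hf.stronglyMeasurable_mk.tendsto_approx x)

/-- Split θ(f_k)G_k - θ(f)G = θ(f_k)(G_k - G) + (θ(f_k) - θ(f))G. The first term is at most `c`
times the assumed error; the second tends to 0 by dominated convergence with majorant 2c|G|. This
carries the chain rule from test functions to Sobolev functions. -/
theorem tendsto_eLpNorm_comp_smul {α E : Type*} [MeasurableSpace α] {μ : Measure α}
    [NormedAddCommGroup E] [NormedSpace ℝ E] {q : ℝ≥0∞} (hq0 : 1 ≤ q) (hq : q ≠ ⊤)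
    {f : α → ℝ} {fk : ℕ → α → ℝ} {G : α → E} {Gk : ℕ → α → E} {θ : ℝ → ℝ} {c : ℝ}
    (hθ : Continuous θ) (hc : ∀ t, |θ t| ≤ c) (hfk : ∀ k, AEStronglyMeasurable (fk k) μ)
    (hf : ∀ᵐ x ∂μ, Tendsto (fun k => fk k x) atTop (𝓝 (f x)))
    (hG : MemLp G q μ) (hGk : ∀ k, AEStronglyMeasurable (Gk k) μ)
    (hlim : Tendsto (fun k => eLpNorm (fun x => G x - Gk k x) q μ) atTop (𝓝 0)) :
    Tendsto (fun k => eLpNorm (fun x => θ (fk k x) • Gk k x - θ (f x) • G x) q μ) atTop (𝓝 0) := by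
  have hc0 : 0 ≤ c := (abs_nonneg _).trans (hc 0)
  have hqpos : q ≠ 0 := (zero_lt_one.trans_le hq0).ne'
  have hqr : 0 < q.toReal := ENNReal.toReal_pos hqpos hq
  have hfm : AEStronglyMeasurable f μ := aestronglyMeasurable_of_tendsto_ae atTop hfk hf
  have hθk : ∀ k, AEStronglyMeasurable (fun x => θ (fk k x)) μ := fun k =>
    hθ.comp_aestronglyMeasurable (hfk k)
  have hθf : AEStronglyMeasurable (fun x => θ (f x)) μ := hθ.comp_aestronglyMeasurable hfm
  have h1 : Tendsto (fun k => eLpNorm (fun x => θ (fk k x) • (Gk k x - G x)) q μ) atTop (𝓝 0) := by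
    have hup : Tendsto (fun k => ENNReal.ofReal c * eLpNorm (fun x => G x - Gk k x) q μ) atTop
        (𝓝 0) := by
      simpa using ENNReal.Tendsto.const_mul hlim (Or.inr ENNReal.ofReal_ne_top)
    refine tendsto_of_tendsto_of_tendsto_of_le_of_le tendsto_const_nhds hup (fun _ => zero_le)
      fun k => eLpNorm_le_mul_eLpNorm_of_ae_le_mul (.of_forall fun x => ?_) q
    rw [norm_smul, norm_sub_rev, Real.norm_eq_abs]
    exact mul_le_mul_of_nonneg_right (hc _) (norm_nonneg _)
  have h2 : Tendsto (fun k => eLpNorm (fun x => (θ (fk k x) - θ (f x)) • G x) q μ) atTop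
      (𝓝 0) := by
    simp_rw [eLpNorm_eq_lintegral_rpow_enorm_toReal hqpos hq]
    have h3 : Tendsto (fun k => ∫⁻ x, ‖(θ (fk k x) - θ (f x)) • G x‖ₑ ^ q.toReal ∂μ) atTop
        (𝓝 (∫⁻ _, 0 ∂μ)) := by
      refine tendsto_lintegral_of_dominated_convergence'
        (fun x => ‖(2 * c) • G x‖ₑ ^ q.toReal) (fun k => ?_) (fun k => .of_forall fun x => ?_)
        ?_ ?_
      · exact (((hθk k).sub hθf).smul hG.1).enorm.pow_const _
      · refine ENNReal.rpow_le_rpow ?_ hqr.le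
        rw [enorm_le_iff_norm_le, norm_smul, norm_smul]
        gcongr
        rw [Real.norm_eq_abs, Real.norm_eq_abs, abs_of_nonneg (by linarith : 0 ≤ 2 * c)]
        exact (abs_sub _ _).trans (by linarith [hc (fk k x), hc (f x)])
      · exact (lintegral_rpow_enorm_lt_top_of_eLpNorm_lt_top hqpos hq (hG.const_smul (2 * c)).2).ne
      · filter_upwards [hf] with x hx
        have h4 : Tendsto (fun k => (θ (fk k x) - θ (f x)) • G x) atTop (𝓝 0) := by
          have := (((hθ.tendsto _).comp hx).sub_const (θ (f x))).smul_const (G x)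
          simpa using this
        have h5 := (ENNReal.continuous_rpow_const (y := q.toReal)).tendsto (0 : ℝ≥0∞)
        rw [ENNReal.zero_rpow_of_pos hqr] at h5
        refine h5.comp ?_
        simpa using h4.enorm
    rw [lintegral_zero] at h3
    have h5 := (ENNReal.continuous_rpow_const (y := 1 / q.toReal)).tendsto (0 : ℝ≥0∞)
    rw [ENNReal.zero_rpow_of_pos (by positivity)] at h5
    exact h5.comp h3
  have h6 := h1.add h2
  rw [add_zero] at h6
  refine tendsto_of_tendsto_of_tendsto_of_le_of_le tendsto_const_nhds h6 (fun _ => zero_le)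
    fun k => ?_
  have : (fun x => θ (fk k x) • Gk k x - θ (f x) • G x) =
      (fun x => θ (fk k x) • (Gk k x - G x)) + fun x => (θ (fk k x) - θ (f x)) • G x := by
    funext x
    simp only [Pi.add_apply]
    module
  rw [this]
  exact eLpNorm_add_le ((hθk k).smul ((hGk k).sub hG.1)) (((hθk k).sub hθf).smul hG.1) hq0

theorem eLpNorm_inner_le {α E : Type*} [MeasurableSpace α] {μ : Measure α}
    [NormedAddCommGroup E] [InnerProductSpace ℝ E] {q r : ℝ≥0∞} [r.HolderTriple q 1]
    {F V : α → E} (hF : AEStronglyMeasurable F μ) (hV : AEStronglyMeasurable V μ) :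
    eLpNorm (fun x => ⟪F x, V x⟫) 1 μ ≤ eLpNorm F r μ * eLpNorm V q μ := by
  have := eLpNorm_le_eLpNorm_mul_eLpNorm'_of_norm (p := r) (q := q) (r := 1) hF hV
    (fun a b => ⟪a, b⟫) 1 (.of_forall fun x => by simpa using norm_inner_le_norm (𝕜 := ℝ) _ _)
  simpa using this

theorem integrable_inner_of_holderTriple {α E : Type*} [MeasurableSpace α] {μ : Measure α}
    [NormedAddCommGroup E] [InnerProductSpace ℝ E] {q r : ℝ≥0∞} [r.HolderTriple q 1]
    {F V : α → E} (hF : MemLp F r μ) (hV : MemLp V q μ) :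
    Integrable (fun x => ⟪F x, V x⟫) μ :=
  memLp_one_iff_integrable.1 ⟨hF.1.inner hV.1,
    (eLpNorm_inner_le (r := r) (q := q) hF.1 hV.1).trans_lt (ENNReal.mul_lt_top hF.2 hV.2)⟩

theorem tendsto_integral_inner {α E : Type*} [MeasurableSpace α] {μ : Measure α}
    [NormedAddCommGroup E] [InnerProductSpace ℝ E] {q r : ℝ≥0∞} [r.HolderTriple q 1]
    {F V : α → E} {Vk : ℕ → α → E} (hF : MemLp F r μ) (hV : MemLp V q μ)
    (hVk : ∀ k, MemLp (Vk k) q μ)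
    (hlim : Tendsto (fun k => eLpNorm (fun x => Vk k x - V x) q μ) atTop (𝓝 0)) :
    Tendsto (fun k => ∫ x, ⟪F x, Vk k x⟫ ∂μ) atTop (𝓝 (∫ x, ⟪F x, V x⟫ ∂μ)) := by
  refine tendsto_integral_of_L1' _ (integrable_inner_of_holderTriple hF hV).1
    (.of_forall fun k => integrable_inner_of_holderTriple hF (hVk k)) ?_
  have hup : Tendsto (fun k => eLpNorm F r μ * eLpNorm (fun x => Vk k x - V x) q μ) atTop
      (𝓝 0) := by
    simpa using ENNReal.Tendsto.const_mul hlim (Or.inr hF.2.ne)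
  refine tendsto_of_tendsto_of_tendsto_of_le_of_le tendsto_const_nhds hup (fun _ => zero_le)
    fun k => ?_
  have : ((fun x => ⟪F x, Vk k x⟫) - fun x => ⟪F x, V x⟫) = fun x => ⟪F x, Vk k x - V x⟫ := by
    funext x; simp [inner_sub_right]
  simp only [this]
  exact eLpNorm_inner_le hF.1 ((hVk k).1.sub hV.1)

/-! ### Test functions: composition, gradients, pairing with a measure -/

section TestFunctions

variable {n : ℕ} {U : Set (Rn n)} {φ : Rn n → ℝ}

theorem IsTestFunction.comp (hφ : IsTestFunction U φ) {S : ℝ → ℝ} (hS : ContDiff ℝ ∞ S)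
    (hS0 : S 0 = 0) : IsTestFunction U (S ∘ φ) :=
  ⟨hS.comp hφ.1, hφ.2.1.comp_left hS0, (tsupport_comp_subset hS0 φ).trans hφ.2.2⟩

theorem norm_gradient (φ : Rn n → ℝ) (x : Rn n) : ‖gradient φ x‖ = ‖fderiv ℝ φ x‖ := by
  rw [← toDual_gradient (𝕜 := ℝ), LinearIsometryEquiv.norm_map]

theorem IsTestFunction.gradient_comp (hφ : IsTestFunction U φ) {S : ℝ → ℝ}
    (hS : ContDiff ℝ ∞ S) (x : Rn n) :
    gradient (S ∘ φ) x = deriv S (φ x) • gradient φ x := by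
  have h1 : HasDerivAt S (deriv S (φ x)) (φ x) :=
    (hS.differentiable (by simp)).differentiableAt.hasDerivAt
  have h2 : HasFDerivAt φ (fderiv ℝ φ x) x :=
    (hφ.1.differentiable (by simp)).differentiableAt.hasFDerivAt
  have h3 := (h1.comp_hasFDerivAt x h2).fderiv
  rw [gradient, gradient, h3, map_smul]

theorem IsTestFunction.continuous_gradient (hφ : IsTestFunction U φ) :
    Continuous (gradient φ) :=
  (InnerProductSpace.toDual ℝ (Rn n)).symm.continuous.comp (hφ.1.continuous_fderiv (by simp))

theorem IsTestFunction.gradient_eq_zero (hφ : IsTestFunction U φ) {x : Rn n} (hx : x ∉ U) :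
    gradient φ x = 0 := by
  have : fderiv ℝ φ x = 0 :=
    image_eq_zero_of_notMem_tsupport fun h => hx (hφ.2.2 (tsupport_fderiv_subset ℝ h))
  rw [gradient, this, map_zero]

theorem IsTestFunction.eq_zero (hφ : IsTestFunction U φ) {x : Rn n} (hx : x ∉ U) : φ x = 0 :=
  image_eq_zero_of_notMem_tsupport fun h => hx (hφ.2.2 h)

theorem IsTestFunction.exists_norm_gradient_le (hφ : IsTestFunction U φ) :
    ∃ c, ∀ x, ‖gradient φ x‖ ≤ c := by
  have hs : HasCompactSupport (gradient φ) :=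
    (hφ.2.1.fderiv ℝ).comp_left (map_zero (InnerProductSpace.toDual ℝ (Rn n)).symm)
  exact hs.exists_bound_of_continuous hφ.continuous_gradient

theorem IsTestFunction.memLp_gradient (hφ : IsTestFunction U φ) (q : ℝ≥0∞) (μ : Measure (Rn n))
    [IsFiniteMeasure μ] : MemLp (gradient φ) q μ := by
  obtain ⟨c, hc⟩ := hφ.exists_norm_gradient_le
  exact MemLp.of_bound hφ.continuous_gradient.aestronglyMeasurable c (.of_forall hc)

theorem IsTestFunction.mono (hφ : IsTestFunction U φ) {V : Set (Rn n)} (h : U ⊆ V) :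
    IsTestFunction V φ := ⟨hφ.1, hφ.2.1, hφ.2.2.trans h⟩

theorem IsTestFunction.abs_signedIntegral_le (hφ : IsTestFunction U φ)
    {k : ℝ} (hk : ∀ x, |φ x| ≤ k) (μ : SignedMeasure (Rn n)) :
    |signedIntegral μ φ| ≤ k * (μ.totalVariation U).toReal := by
  have key : ∀ (ν : Measure (Rn n)) [IsFiniteMeasure ν], |∫ x, φ x ∂ν| ≤ k * (ν U).toReal := by
    intro ν _
    rw [← setIntegral_eq_integral_of_forall_compl_eq_zero (s := U) fun x hx => hφ.eq_zero hx]
    exact norm_setIntegral_le_of_norm_le_const (f := φ) (measure_lt_top ν U) fun x _ => hk x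
  have h1 := key μ.toJordanDecomposition.posPart
  have h2 := key μ.toJordanDecomposition.negPart
  rw [SignedMeasure.totalVariation, Measure.add_apply,
    ENNReal.toReal_add (measure_ne_top _ _) (measure_ne_top _ _), mul_add]
  exact (abs_sub _ _).trans (add_le_add h1 h2)

end TestFunctions

/-! ### Testing the difference of the equations -/

theorem MemW1pZero.exists_seq {n : ℕ} {p : ℝ} (hp : 1 ≤ p) {U : Set (Rn n)} {v : Rn n → ℝ}
    {Dv : Rn n → Rn n} (h : MemW1pZero p U v Dv) :
    ∃ φ : ℕ → Rn n → ℝ, (∀ k, IsTestFunction U (φ k)) ∧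
      (∀ᵐ x ∂volume.restrict U, Tendsto (fun k => φ k x) atTop (𝓝 (v x))) ∧
      Tendsto (fun k => eLpNorm (fun x => Dv x - gradient (φ k) x) (ENNReal.ofReal p)
        (volume.restrict U)) atTop (𝓝 0) := by
  obtain ⟨⟨-, hv, -⟩, φ, hφ, h1, h2⟩ := h
  have h3 : TendstoInMeasure (volume.restrict U) φ atTop v := by
    refine tendstoInMeasure_of_tendsto_eLpNorm (p := ENNReal.ofReal p) (by simp; linarith)
      (fun k => (hφ k).1.continuous.aestronglyMeasurable) hv.1 ?_
    refine h1.congr fun k => ?_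
    exact eLpNorm_sub_comm _ _ _ _
  obtain ⟨ns, hns, hae⟩ := h3.exists_seq_tendsto_ae
  exact ⟨fun k => φ (ns k), fun k => hφ _, hae, h2.comp hns.tendsto_atTop⟩

/-- The growth condition puts A(x, Du) in the space with exponent p/(p-1), so it pairs with
gradients in L^p. -/
theorem holderTriple_ofReal {p : ℝ} (hp : 1 < p) :
    (ENNReal.ofReal p / ENNReal.ofReal (p - 1)).HolderTriple (ENNReal.ofReal p) 1 := by
  have hp1 : 0 < p - 1 := by linarith
  have hp0 : 0 < p := by linarith
  refine ⟨?_⟩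
  rw [← ENNReal.ofReal_div_of_pos hp1, ← ENNReal.ofReal_inv_of_pos (by positivity),
    ← ENNReal.ofReal_inv_of_pos hp0, ← ENNReal.ofReal_add (by positivity) (by positivity)]
  rw [inv_one, ← ENNReal.ofReal_one]
  congr 1
  field_simp
  ring

section Equation

variable {n : ℕ} {p Λ : ℝ} {A : Rn n → Rn n → Rn n}

theorem IsNonlinearity.memLp (hA : IsNonlinearity p Λ A) (hp : 1 < p) {U : Set (Rn n)}
    {Du : Rn n → Rn n} (hDu : MemLp Du (ENNReal.ofReal p) (volume.restrict U)) :
    MemLp (fun x => A x (Du x)) (ENNReal.ofReal p / ENNReal.ofReal (p - 1))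
      (volume.restrict U) := by
  have h1 := hDu.norm_rpow_div (ENNReal.ofReal (p - 1))
  rw [ENNReal.toReal_ofReal (by linarith)] at h1
  refine h1.of_le_mul (c := Λ) (aemeasurable_superposition (fun ξ => (hA.measurable ξ).restrict)
    (ae_restrict_of_ae hA.continuous) hDu.1).aestronglyMeasurable ?_
  filter_upwards [ae_restrict_of_ae hA.growth] with x hx
  rw [Real.norm_of_nonneg (Real.rpow_nonneg (norm_nonneg _) _)]
  exact hx _

/-- The difference of the two equations, tested with a smooth function. -/
theorem abs_integral_inner_gradient_le (hA : IsNonlinearity p Λ A) (hp : 1 < p)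
    {B Ω : Set (Rn n)} (hB : volume B ≠ ⊤) (hΩ : IsOpen Ω) (hBΩ : B ⊆ Ω)
    {μ : SignedMeasure (Rn n)} {Du Dw : Rn n → Rn n}
    (hDu : MemLp Du (ENNReal.ofReal p) (volume.restrict B))
    (hDw : MemLp Dw (ENNReal.ofReal p) (volume.restrict B))
    (hu : SolvesIn A Ω Du μ) (hw : SolvesIn A B Dw 0) {ψ : Rn n → ℝ} (hψ : IsTestFunction B ψ)
    {k : ℝ} (hk : ∀ x, |ψ x| ≤ k) :
    |∫ x in B, ⟪A x (Dw x) - A x (Du x), gradient ψ x⟫| ≤ k * (μ.totalVariation B).toReal := by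
  have : IsFiniteMeasure (volume.restrict B) := ⟨by simpa using hB.lt_top⟩
  have hH := holderTriple_ofReal hp
  have hg := hψ.memLp_gradient (ENNReal.ofReal p) (volume.restrict B)
  have h1 : ∫ x in B, ⟪A x (Dw x), gradient ψ x⟫ = 0 := by
    rw [hw ψ hψ]
    simp [signedIntegral, SignedMeasure.toJordanDecomposition_zero]
  have h2 : ∫ x in B, ⟪A x (Du x), gradient ψ x⟫ = signedIntegral μ ψ := by
    rw [← hu ψ (hψ.mono hBΩ)]
    refine (setIntegral_eq_of_subset_of_forall_sdiff_eq_zero hΩ.measurableSet hBΩ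
      fun x hx => ?_).symm
    rw [hψ.gradient_eq_zero hx.2, inner_zero_right]
  simp_rw [inner_sub_left]
  rw [integral_sub (integrable_inner_of_holderTriple (hA.memLp hp hDw) hg)
    (integrable_inner_of_holderTriple (hA.memLp hp hDu) hg), h1, h2, zero_sub, abs_neg]
  exact hψ.abs_signedIntegral_le hk μ

/-- Approximate `v` by test functions φ_j. Each S∘φ_j is an admissible test function bounded by `k`,
so the right-hand side is uniform in j, and boundedness of S' gives convergence of the gradients in
L^p. -/
theorem integral_deriv_comp_mul_inner_le (hA : IsNonlinearity p Λ A) (hp : 1 < p)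
    {B Ω : Set (Rn n)} (hB : volume B ≠ ⊤) (hΩ : IsOpen Ω) (hBΩ : B ⊆ Ω)
    {μ : SignedMeasure (Rn n)} {Du Dw : Rn n → Rn n}
    (hDu : MemLp Du (ENNReal.ofReal p) (volume.restrict B))
    (hDw : MemLp Dw (ENNReal.ofReal p) (volume.restrict B))
    (hu : SolvesIn A Ω Du μ) (hw : SolvesIn A B Dw 0) {v : Rn n → ℝ}
    (hv : MemW1pZero p B v fun x => Dw x - Du x) {S : ℝ → ℝ} (hS : ContDiff ℝ ∞ S)
    (hS0 : S 0 = 0) {k c : ℝ} (hk : ∀ t, |S t| ≤ k) (hc : ∀ t, |deriv S t| ≤ c) :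
    ∫ x in B, deriv S (v x) * ⟪A x (Dw x) - A x (Du x), Dw x - Du x⟫ ≤
      k * (μ.totalVariation B).toReal := by
  have : IsFiniteMeasure (volume.restrict B) := ⟨by simpa using hB.lt_top⟩
  have hH := holderTriple_ofReal hp
  obtain ⟨φ, hφ, hae, hlim⟩ := hv.exists_seq hp.le
  have hS' : Continuous (deriv S) := hS.continuous_deriv (by simp)
  have hψ : ∀ j, IsTestFunction B (S ∘ φ j) := fun j => (hφ j).comp hS hS0
  have hφm : ∀ j, AEStronglyMeasurable (φ j) (volume.restrict B) := fun j =>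
    (hφ j).1.continuous.aestronglyMeasurable
  have hvm : AEStronglyMeasurable v (volume.restrict B) := hv.1.2.1.1
  have h1 := tendsto_eLpNorm_comp_smul (by simpa using hp.le) ENNReal.ofReal_ne_top hS' hc
    hφm hae hv.1.2.2
    (fun j => (hφ j).continuous_gradient.aestronglyMeasurable) hlim
  have hV : MemLp (fun x => deriv S (v x) • (Dw x - Du x)) (ENNReal.ofReal p)
      (volume.restrict B) :=
    hv.1.2.2.of_le_mul (c := c) ((hS'.comp_aestronglyMeasurable hvm).smul hv.1.2.2.1)
      (.of_forall fun x => by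
        rw [norm_smul, Real.norm_eq_abs]
        exact mul_le_mul_of_nonneg_right (hc _) (norm_nonneg _))
  have hVk : ∀ j, MemLp (fun x => deriv S (φ j x) • gradient (φ j) x) (ENNReal.ofReal p)
      (volume.restrict B) := fun j => by
    have := (hψ j).memLp_gradient (ENNReal.ofReal p) (volume.restrict B)
    rwa [show gradient (S ∘ φ j) = fun x => deriv S (φ j x) • gradient (φ j) x from
      funext fun x => (hφ j).gradient_comp hS x] at this
  have h2 := tendsto_integral_inner ((hA.memLp hp hDw).sub (hA.memLp hp hDu)) hV hVk h1
  simp only [Pi.sub_apply, inner_smul_right] at h2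
  refine le_of_tendsto' h2 fun j => ?_
  have h3 := abs_integral_inner_gradient_le hA hp hB hΩ hBΩ hDu hDw hu hw (hψ j)
    (fun x => hk (φ j x))
  simp only [(hφ j).gradient_comp hS, inner_smul_right] at h3
  exact (le_abs_self _).trans h3

end Equation

/-! ### Sobolev's inequality for compositions -/

/-- The Gagliardo–Nirenberg–Sobolev inequality with an L¹ gradient holds for G∘φ_k, compactly
supported since `G 0 = 0`. Fatou's lemma passes to the limit on the left, L¹ convergence of the
gradients on the right. -/
theorem MemW1pZero.lintegral_comp_rpow_le {n : ℕ} {p : ℝ} (hp : 1 ≤ p)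
    {U : Set (Rn n)} (hU : volume U ≠ ⊤) {v : Rn n → ℝ} {Dv : Rn n → Rn n}
    (hv : MemW1pZero p U v Dv) {G : ℝ → ℝ} (hG : ContDiff ℝ ∞ G) (hG0 : G 0 = 0) {c : ℝ}
    (hc : ∀ t, |deriv G t| ≤ c) {q : ℝ} (hq : (n : ℝ).HolderConjugate q) :
    ∫⁻ x in U, ‖G (v x)‖ₑ ^ q ≤ lintegralPowLePowLIntegralFDerivConst (volume : Measure (Rn n)) q *
      (∫⁻ x in U, ‖deriv G (v x) • Dv x‖ₑ) ^ q := by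
  have : IsFiniteMeasure (volume.restrict U) := ⟨by simpa using hU.lt_top⟩
  obtain ⟨φ, hφ, hae, hlim⟩ := hv.exists_seq hp
  set K : ℝ≥0∞ :=
    ((lintegralPowLePowLIntegralFDerivConst (volume : Measure (Rn n)) q : NNReal) : ℝ≥0∞) with hK
  have hKt : K ≠ ⊤ := ENNReal.coe_ne_top
  have hq0 : 0 < q := hq.symm.pos
  have hG' : Continuous (deriv G) := hG.continuous_deriv (by simp)
  have hp' : (1 : ℝ≥0∞) ≤ ENNReal.ofReal p := by simpa using hp
  have hgm : ∀ j, AEStronglyMeasurable (gradient (φ j)) (volume.restrict U) := fun j =>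
    (hφ j).continuous_gradient.aestronglyMeasurable
  have hlim1 : Tendsto (fun k => eLpNorm (fun x => Dv x - gradient (φ k) x) 1
      (volume.restrict U)) atTop (𝓝 0) := by
    have hup := ENNReal.Tendsto.mul_const (b := (volume.restrict U) Set.univ ^
      (1 / (1 : ℝ≥0∞).toReal - 1 / (ENNReal.ofReal p).toReal)) hlim (Or.inr ?_)
    · rw [zero_mul] at hup
      exact tendsto_of_tendsto_of_tendsto_of_le_of_le tendsto_const_nhds hup (fun _ => zero_le)
        fun k => eLpNorm_le_eLpNorm_mul_rpow_measure_univ hp' (hv.1.2.2.1.sub (hgm k))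
    · refine (ENNReal.rpow_lt_top_of_nonneg ?_ (measure_ne_top _ _)).ne
      rw [ENNReal.toReal_one, ENNReal.toReal_ofReal (by linarith), sub_nonneg]
      exact one_div_le_one_div_of_le one_pos hp
  have hDv1 : MemLp Dv 1 (volume.restrict U) := hv.1.2.2.mono_exponent hp'
  have h1 := tendsto_eLpNorm_comp_smul le_rfl ENNReal.one_ne_top hG' hc
    (fun j => (hφ j).1.continuous.aestronglyMeasurable) hae hDv1 hgm hlim1
  set V : Rn n → Rn n := fun x => deriv G (v x) • Dv x with hVdef
  have hVm : AEStronglyMeasurable V (volume.restrict U) :=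
    (hG'.comp_aestronglyMeasurable hv.1.2.1.1).smul hDv1.1
  have hstep : ∀ k, ∫⁻ x in U, ‖G (φ k x)‖ₑ ^ q ≤ K * (eLpNorm V 1 (volume.restrict U) +
      eLpNorm (fun x => deriv G (φ k x) • gradient (φ k) x - V x) 1 (volume.restrict U)) ^ q := by
    intro k
    have hψ := (hφ k).comp hG hG0
    have h2 := lintegral_pow_le_pow_lintegral_fderiv (volume : Measure (Rn n))
      (hψ.1.of_le (by simp)) hψ.2.1 (p := q) (by simpa using hq)
    refine (setLIntegral_le_lintegral U _).trans (h2.trans ?_)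
    refine mul_le_mul_right (ENNReal.rpow_le_rpow ?_ hq0.le) _
    have h3 : ∫⁻ x, ‖fderiv ℝ (G ∘ φ k) x‖ₑ =
        ∫⁻ x in U, ‖deriv G (φ k x) • gradient (φ k) x‖ₑ := by
      have h4 : ∀ x, ‖fderiv ℝ (G ∘ φ k) x‖ₑ = ‖deriv G (φ k x) • gradient (φ k) x‖ₑ := fun x => by
        rw [← (hφ k).gradient_comp hG, ← ofReal_norm, ← ofReal_norm,
          norm_gradient]
      simp_rw [h4]
      refine (setLIntegral_eq_of_support_subset ?_).symm
      intro x hx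
      by_contra hxU
      exact hx (by simp [(hφ k).gradient_eq_zero hxU])
    rw [h3, ← eLpNorm_one_eq_lintegral_enorm]
    have h5 : (fun x => deriv G (φ k x) • gradient (φ k) x) =
        V + fun x => deriv G (φ k x) • gradient (φ k) x - V x := by
      funext x; simp
    conv_lhs => rw [h5]
    refine eLpNorm_add_le hVm (AEStronglyMeasurable.sub ?_ hVm) le_rfl
    exact ((hG'.comp (hφ k).1.continuous).aestronglyMeasurable).smul (hgm k)
  have hlim2 := (ENNReal.Tendsto.const_mul (a := K) (((ENNReal.continuous_rpow_const
    (y := q)).tendsto _).comp (h1.const_add (eLpNorm V 1 (volume.restrict U)))) (Or.inr hKt))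
  rw [add_zero] at hlim2
  calc ∫⁻ x in U, ‖G (v x)‖ₑ ^ q
      = ∫⁻ x in U, liminf (fun k => ‖G (φ k x)‖ₑ ^ q) atTop := by
        refine lintegral_congr_ae ?_
        filter_upwards [hae] with x hx
        refine (Tendsto.liminf_eq ?_).symm
        exact ((ENNReal.continuous_rpow_const (y := q)).tendsto _).comp
          ((hG.continuous.tendsto _).comp hx).enorm
    _ ≤ liminf (fun k => ∫⁻ x in U, ‖G (φ k x)‖ₑ ^ q) atTop := by
        refine lintegral_liminf_le' fun k => ?_
        exact ((hG.continuous.comp (hφ k).1.continuous).enorm.measurable.pow_const _).aemeasurable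
    _ ≤ K * eLpNorm V 1 (volume.restrict U) ^ q := by
        rw [← hlim2.liminf_eq]
        exact liminf_le_liminf (.of_forall hstep)
    _ = _ := by rw [eLpNorm_one_eq_lintegral_enorm]

/-! ### The weight (1 + t²)^(1/2) and the functions built from it -/

theorem one_le_sqrt_one_add_sq (t : ℝ) : 1 ≤ √(1 + t ^ 2) :=
  Real.one_le_sqrt.2 (by nlinarith [sq_nonneg t])

theorem sqrt_one_add_sq_rpow (t s : ℝ) : √(1 + t ^ 2) ^ s = (1 + t ^ 2) ^ (s / 2) := by
  rw [Real.sqrt_eq_rpow, ← Real.rpow_mul (by positivity)]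
  congr 1
  ring

theorem contDiff_one_add_sq_rpow (s : ℝ) : ContDiff ℝ ∞ fun t : ℝ => (1 + t ^ 2) ^ s :=
  ContDiff.rpow_const_of_ne (by fun_prop) fun t => by positivity

/-- For `ξ > 1` the weight `(1 + t²)^{-ξ/2}` has a bounded smooth primitive. -/
theorem exists_bounded_primitive {ξ : ℝ} (hξ : 1 < ξ) :
    ∃ (S : ℝ → ℝ) (k : ℝ), 0 ≤ k ∧ ContDiff ℝ ∞ S ∧ S 0 = 0 ∧ (∀ t, |S t| ≤ k) ∧
      ∀ t, deriv S t = √(1 + t ^ 2) ^ (-ξ) := by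
  set f : ℝ → ℝ := fun t => (1 + t ^ 2) ^ (-ξ / 2) with hf
  have hfc : Continuous f := (contDiff_one_add_sq_rpow (-ξ / 2)).continuous
  have hf0 : ∀ t, 0 ≤ f t := fun t => by positivity
  have hfi : Integrable f := by
    simpa [hf] using integrable_rpow_neg_one_add_norm_sq (E := ℝ) (μ := volume) (r := ξ) (by simpa)
  have hS : ∀ t, HasDerivAt (fun t => ∫ s in (0 : ℝ)..t, f s) (f t) t := fun t =>
    intervalIntegral.integral_hasDerivAt_right (hfc.intervalIntegrable _ _)
      (hfc.stronglyMeasurableAtFilter _ _) hfc.continuousAt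
  have hd : deriv (fun t => ∫ s in (0 : ℝ)..t, f s) = f := funext fun t => (hS t).deriv
  refine ⟨fun t => ∫ s in (0 : ℝ)..t, f s, ∫ s, f s, integral_nonneg (f := f) hf0, ?_, by simp,
    fun t => ?_, fun t => ?_⟩
  · rw [contDiff_infty_iff_deriv, hd]
    exact ⟨fun t => (hS t).differentiableAt, contDiff_one_add_sq_rpow _⟩
  · rw [← Real.norm_eq_abs]
    refine (intervalIntegral.norm_integral_le_integral_norm_uIoc).trans ?_
    simp_rw [Real.norm_of_nonneg (hf0 _)]
    exact setIntegral_le_integral hfi (.of_forall hf0)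
  · rw [hd, sqrt_one_add_sq_rpow]

/-- The derivative is τ t W^(τ-2) with |t| ≤ W and τ ≤ 1. Subtracting 1 gives value 0 at 0, as
composition with test functions needs. For τ = 1 - ξ/2 the bound is W^(-ξ/2), half the power of the
tested weight. -/
theorem exists_power_primitive {τ : ℝ} (hτ0 : 0 ≤ τ) (hτ1 : τ ≤ 1) :
    ∃ G : ℝ → ℝ, ContDiff ℝ ∞ G ∧ G 0 = 0 ∧ (∀ t, G t = √(1 + t ^ 2) ^ τ - 1) ∧
      ∀ t, |deriv G t| ≤ √(1 + t ^ 2) ^ (τ - 1) := by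
  refine ⟨fun t => (1 + t ^ 2) ^ (τ / 2) - 1, (contDiff_one_add_sq_rpow _).sub contDiff_const,
    by simp, fun t => by rw [sqrt_one_add_sq_rpow], fun t => ?_⟩
  have h1 : HasDerivAt (fun t : ℝ => 1 + t ^ 2) (2 * t) t := by
    simpa using (hasDerivAt_pow 2 t).const_add 1
  have h2 := (h1.rpow_const (p := τ / 2) (Or.inl (by positivity))).sub_const 1
  rw [h2.deriv]
  have hW := one_le_sqrt_one_add_sq t
  have hW0 : 0 < √(1 + t ^ 2) := by linarith
  have h3 : (1 + t ^ 2) ^ (τ / 2 - 1) = √(1 + t ^ 2) ^ (τ - 2) := by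
    rw [sqrt_one_add_sq_rpow]; congr 1; ring
  have h4 : |t| ≤ √(1 + t ^ 2) := Real.abs_le_sqrt (by linarith)
  have h5 : √(1 + t ^ 2) ^ (τ - 1) = √(1 + t ^ 2) * √(1 + t ^ 2) ^ (τ - 2) := by
    nth_rw 2 [← Real.rpow_one √(1 + t ^ 2)]
    rw [← Real.rpow_add hW0]; congr 1; ring
  rw [h3, h5, show 2 * t * (τ / 2) * √(1 + t ^ 2) ^ (τ - 2) =
    τ * t * √(1 + t ^ 2) ^ (τ - 2) by ring, abs_mul, abs_mul, abs_of_nonneg hτ0,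
    abs_of_nonneg (Real.rpow_nonneg hW0.le _)]
  gcongr
  nlinarith [abs_nonneg t]

/-! ### The weighted Sobolev inequality on balls -/

theorem volume_real_ball {n : ℕ} (hn : 1 ≤ n) (x : Rn n) {r : ℝ} (hr : 0 ≤ r) :
    volume.real (Metric.ball x r) = r ^ n * volume.real (Metric.ball (0 : Rn n) 1) := by
  have : Nontrivial (Rn n) := by
    have : Nonempty (Fin n) := ⟨⟨0, hn⟩⟩
    infer_instance
  rw [Measure.real, Measure.addHaar_ball _ _ hr, ENNReal.toReal_mul,
    ENNReal.toReal_ofReal (by positivity), finrank_euclideanSpace_fin]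
  rfl

theorem holderConjugate_dimension {n : ℕ} (hn : 2 ≤ n) :
    (n : ℝ).HolderConjugate ((n : ℝ) / (n - 1)) := by
  have : (2 : ℝ) ≤ n := by exact_mod_cast hn
  refine Real.holderConjugate_iff.2 ⟨by linarith, ?_⟩
  have : (n : ℝ) - 1 ≠ 0 := by linarith
  field_simp
  ring

theorem one_add_rpow_le {x q : ℝ} (hx : 0 ≤ x) (hq : 0 ≤ q) :
    (1 + x) ^ q ≤ 2 ^ q * (1 + x ^ q) := by
  have hxq : 0 ≤ x ^ q := by positivity
  rcases le_total x 1 with h | h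
  · calc (1 + x) ^ q ≤ 2 ^ q := by gcongr; linarith
      _ ≤ 2 ^ q * (1 + x ^ q) := le_mul_of_one_le_right (by positivity) (by linarith)
  · calc (1 + x) ^ q ≤ (2 * x) ^ q := by gcongr; linarith
      _ = 2 ^ q * x ^ q := Real.mul_rpow (by norm_num) hx
      _ ≤ 2 ^ q * (1 + x ^ q) := by gcongr; linarith

/-- Sobolev's inequality for powers of `(1 + (v/H)²)^{1/2}`. -/
theorem exists_average_weight_rpow_le {n : ℕ} (hn : 2 ≤ n) :
    ∃ C : ℝ, 0 ≤ C ∧ ∀ (p : ℝ) (x₀ : Rn n) (R H τ : ℝ) (v : Rn n → ℝ) (Dv : Rn n → Rn n),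
      1 ≤ p → 0 < R → 0 < H → 0 ≤ τ → τ ≤ 1 → MemW1pZero p (Metric.ball x₀ (2 * R)) v Dv →
      IntegrableOn (fun x => √(1 + (H⁻¹ * v x) ^ 2) ^ (τ * (n / (n - 1))))
        (Metric.ball x₀ (2 * R)) ∧
      (⨍ x in Metric.ball x₀ (2 * R), √(1 + (H⁻¹ * v x) ^ 2) ^ (τ * (n / (n - 1)))) ^
          (1 - 1 / (n : ℝ)) ≤
        C * (R / H * ⨍ x in Metric.ball x₀ (2 * R),
          √(1 + (H⁻¹ * v x) ^ 2) ^ (τ - 1) * ‖Dv x‖) + 2 := by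
  have hn2 : (2 : ℝ) ≤ n := by exact_mod_cast hn
  set q : ℝ := n / (n - 1) with hq
  have hconj := holderConjugate_dimension hn
  have hq0 : 0 < q := hconj.symm.pos
  have hqn : 1 - 1 / (n : ℝ) = 1 / q := by
    have : (n : ℝ) - 1 ≠ 0 := by linarith
    rw [hq]; field_simp
  set K : NNReal := lintegralPowLePowLIntegralFDerivConst (volume : Measure (Rn n)) q with hK
  set Vone : ℝ := volume.real (Metric.ball (0 : Rn n) 1) with hVone
  have hVone0 : 0 ≤ Vone := measureReal_nonneg
  -- One factor 2 is (2^q)^(1/q), the other comes from the radius 2R.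
  refine ⟨4 * (K : ℝ) ^ (1 / q) * Vone ^ (1 / (n : ℝ)), by positivity, ?_⟩
  intro p x₀ R H τ v Dv hp hR hH hτ0 hτ1 hv
  set B := Metric.ball x₀ (2 * R) with hB
  have hBt : volume B ≠ ⊤ := Metric.isBounded_ball.measure_lt_top.ne
  have : IsFiniteMeasure (volume.restrict B) := ⟨by simpa using hBt.lt_top⟩
  set V := volume.real B with hV
  have hV0 : 0 < V := ENNReal.toReal_pos (Metric.measure_ball_pos _ _ (by positivity)).ne' hBt
  have hVn : V ^ (1 / (n : ℝ)) = 2 * R * Vone ^ (1 / (n : ℝ)) := by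
    rw [hV, hB, volume_real_ball (by omega) _ (by positivity),
      Real.mul_rpow (by positivity) hVone0, ← Real.rpow_natCast, ← Real.rpow_mul (by positivity),
      mul_one_div_cancel (by linarith), Real.rpow_one]
  set W : Rn n → ℝ := fun x => √(1 + (H⁻¹ * v x) ^ 2) with hW
  have hW1 : ∀ x, 1 ≤ W x := fun x => one_le_sqrt_one_add_sq _
  have hW0 : ∀ x, 0 < W x := fun x => zero_lt_one.trans_le (hW1 x)
  have hvm : AEMeasurable v (volume.restrict B) := hv.1.2.1.1.aemeasurable
  have hWm : AEMeasurable W (volume.restrict B) :=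
    (((hvm.const_mul H⁻¹).pow_const 2).const_add 1).sqrt
  obtain ⟨G, hG, hG0, hGW, hG'⟩ := exists_power_primitive hτ0 hτ1
  set GH : ℝ → ℝ := fun t => G (H⁻¹ * t) with hGH
  have hGHc : ContDiff ℝ ∞ GH := hG.comp (by fun_prop)
  have hGH0 : GH 0 = 0 := by simp [hGH, hG0]
  have hGHd : ∀ t, |deriv GH t| ≤ H⁻¹ * √(1 + (H⁻¹ * t) ^ 2) ^ (τ - 1) := fun t => by
    rw [hGH, deriv_comp_mul_left, smul_eq_mul, abs_mul, abs_of_pos (inv_pos.2 hH)]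
    exact mul_le_mul_of_nonneg_left (hG' _) (by positivity)
  have hWτ : ∀ t : ℝ, √(1 + (H⁻¹ * t) ^ 2) ^ (τ - 1) ≤ 1 := fun t =>
    Real.rpow_le_one_of_one_le_of_nonpos (one_le_sqrt_one_add_sq _) (by linarith)
  have hGHb : ∀ t, |deriv GH t| ≤ H⁻¹ := fun t =>
    (hGHd t).trans (mul_le_of_le_one_right (by positivity) (hWτ t))
  have hSob := hv.lintegral_comp_rpow_le hp hBt hGHc hGH0 hGHb hconj
  have hDvi : Integrable Dv (volume.restrict B) :=
    hv.1.2.2.integrable (by simpa using hp)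
  have hXi : Integrable (fun x => W x ^ (τ - 1) * ‖Dv x‖) (volume.restrict B) := by
    refine hDvi.norm.mono' ((hWm.pow_const _).mul hDvi.norm.aemeasurable).aestronglyMeasurable
      (.of_forall fun x => ?_)
    rw [Real.norm_of_nonneg (mul_nonneg (Real.rpow_nonneg (hW0 x).le _) (norm_nonneg _))]
    exact mul_le_of_le_one_left (norm_nonneg _) (hWτ _)
  set X := ∫ x in B, W x ^ (τ - 1) * ‖Dv x‖ with hX
  have hX0 : 0 ≤ X := integral_nonneg fun x =>
    mul_nonneg (Real.rpow_nonneg (hW0 x).le _) (norm_nonneg _)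
  have h1 : ∫⁻ x in B, ‖deriv GH (v x) • Dv x‖ₑ ≤ ENNReal.ofReal (H⁻¹ * X) := by
    rw [hX, ← integral_const_mul, ofReal_integral_eq_lintegral_ofReal (hXi.const_mul _)
      (.of_forall fun x => mul_nonneg (by positivity)
        (mul_nonneg (Real.rpow_nonneg (hW0 x).le _) (norm_nonneg _)))]
    refine lintegral_mono fun x => ?_
    rw [← ofReal_norm, norm_smul, Real.norm_eq_abs, ← mul_assoc]
    exact ENNReal.ofReal_le_ofReal (mul_le_mul_of_nonneg_right (hGHd _) (norm_nonneg _))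
  have hGpos : ∀ x, 0 ≤ GH (v x) := fun x => by
    rw [hGH]; simp only [hGW]
    linarith [Real.one_le_rpow (hW1 x) hτ0]
  have h2 : ∫⁻ x in B, ENNReal.ofReal (GH (v x) ^ q) ≤ ENNReal.ofReal (K * (H⁻¹ * X) ^ q) := by
    calc ∫⁻ x in B, ENNReal.ofReal (GH (v x) ^ q) = ∫⁻ x in B, ‖GH (v x)‖ₑ ^ q := by
          refine lintegral_congr fun x => ?_
          rw [← ofReal_norm, Real.norm_of_nonneg (hGpos x),
            ENNReal.ofReal_rpow_of_nonneg (hGpos x) hq0.le]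
      _ ≤ K * ENNReal.ofReal (H⁻¹ * X) ^ q := hSob.trans (by gcongr)
      _ = _ := by
          rw [ENNReal.ofReal_mul (NNReal.coe_nonneg K), ENNReal.ofReal_rpow_of_nonneg (by positivity) hq0.le,
            ENNReal.ofReal_coe_nnreal]
  have hGq0 : ∀ x, 0 ≤ GH (v x) ^ q := fun x => Real.rpow_nonneg (hGpos x) _
  have hGm : AEStronglyMeasurable (fun x => GH (v x) ^ q) (volume.restrict B) :=
    ((hGHc.continuous.measurable.comp_aemeasurable hvm).pow_const _).aestronglyMeasurable
  have hGi : Integrable (fun x => GH (v x) ^ q) (volume.restrict B) :=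
    ⟨hGm, (hasFiniteIntegral_iff_ofReal (.of_forall hGq0)).2
      (h2.trans_lt ENNReal.ofReal_lt_top)⟩
  have h3 : ∫ x in B, GH (v x) ^ q ≤ K * (H⁻¹ * X) ^ q := by
    rw [← ofReal_integral_eq_lintegral_ofReal hGi (.of_forall hGq0)] at h2
    exact (ENNReal.ofReal_le_ofReal_iff (by positivity)).1 h2
  have hWG : ∀ x, W x ^ (τ * q) ≤ 2 ^ q * (1 + GH (v x) ^ q) := fun x => by
    have : W x ^ τ = 1 + GH (v x) := by rw [hGH]; simp only [hGW, hW]; ring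
    rw [Real.rpow_mul (hW0 x).le, this]
    exact one_add_rpow_le (hGpos x) hq0.le
  have hWq0 : ∀ x, 0 ≤ W x ^ (τ * q) := fun x => Real.rpow_nonneg (hW0 x).le _
  have hmaj : Integrable (fun x => 2 ^ q * (1 + GH (v x) ^ q)) (volume.restrict B) :=
    ((integrable_const 1).add hGi).const_mul _
  have hWi : Integrable (fun x => W x ^ (τ * q)) (volume.restrict B) := by
    refine hmaj.mono' (hWm.pow_const _).aestronglyMeasurable (.of_forall fun x => ?_)
    rw [Real.norm_of_nonneg (hWq0 x)]
    exact hWG x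
  refine ⟨hWi, ?_⟩
  have h4 : ∫ x in B, W x ^ (τ * q) ≤ 2 ^ q * (V + K * (H⁻¹ * X) ^ q) := by
    calc ∫ x in B, W x ^ (τ * q) ≤ ∫ x in B, 2 ^ q * (1 + GH (v x) ^ q) :=
          integral_mono hWi hmaj hWG
      _ = 2 ^ q * (V + ∫ x in B, GH (v x) ^ q) := by
          rw [integral_const_mul, integral_add (integrable_const 1) hGi]
          simp [hV, Measure.real]
      _ ≤ _ := by gcongr
  rw [setAverage_eq, setAverage_eq, hqn, smul_eq_mul, smul_eq_mul]
  change (V⁻¹ * ∫ x in B, W x ^ (τ * q)) ^ (1 / q) ≤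
    4 * (K : ℝ) ^ (1 / q) * Vone ^ (1 / (n : ℝ)) * (R / H * (V⁻¹ * X)) + 2
  have hq1 : 1 / q ≤ 1 := by
    rw [← hqn]
    have : 0 ≤ 1 / (n : ℝ) := by positivity
    linarith
  have hVq : V⁻¹ ^ (1 / q) * V = V ^ (1 / (n : ℝ)) := by
    rw [Real.inv_rpow hV0.le, ← Real.rpow_neg hV0.le]
    conv_lhs => rw [← Real.rpow_one V, ← Real.rpow_mul hV0.le, ← Real.rpow_add hV0]
    congr 1
    linarith
  calc (V⁻¹ * ∫ x in B, W x ^ (τ * q)) ^ (1 / q)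
      ≤ (V⁻¹ * (2 ^ q * (V + K * (H⁻¹ * X) ^ q))) ^ (1 / q) := by
        refine Real.rpow_le_rpow (mul_nonneg (by positivity) (integral_nonneg hWq0)) ?_
          (by positivity)
        gcongr
    _ = 2 * (1 + V⁻¹ * K * (H⁻¹ * X) ^ q) ^ (1 / q) := by
        have : V⁻¹ * (2 ^ q * (V + K * (H⁻¹ * X) ^ q)) =
            2 ^ q * (1 + V⁻¹ * K * (H⁻¹ * X) ^ q) := by
          field_simp
        rw [this, Real.mul_rpow (by positivity) (by positivity), ← Real.rpow_mul (by norm_num),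
          mul_one_div_cancel hq0.ne', Real.rpow_one]
    _ ≤ 2 * (1 ^ (1 / q) + (V⁻¹ * K * (H⁻¹ * X) ^ q) ^ (1 / q)) := by
        gcongr
        exact Real.rpow_add_le_add_rpow zero_le_one (by positivity) (by positivity) hq1
    _ = 2 * (K : ℝ) ^ (1 / q) * H⁻¹ * (V⁻¹ ^ (1 / q) * V) * (V⁻¹ * X) + 2 := by
        rw [Real.one_rpow, Real.mul_rpow (by positivity) (by positivity),
          Real.mul_rpow (by positivity) (by positivity), ← Real.rpow_mul (by positivity),
          mul_one_div_cancel hq0.ne', Real.rpow_one]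
        field_simp
        ring
    _ = _ := by
        rw [hVq, hVn]
        field_simp
        ring

/-! ### Arithmetic of the exponents -/

theorem one_lt_of_lt_exponent {N p : ℝ} (hN : 2 ≤ N) (h : (3 * N - 2) / (2 * N - 1) < p) :
    1 < p := by
  refine lt_of_le_of_lt ?_ h
  rw [le_div_iff₀ (by linarith)]
  linarith

theorem two_sub_mul_lt {N p : ℝ} (hN : 2 ≤ N) (h : (3 * N - 2) / (2 * N - 1) < p) :
    (2 - p) * (N - 1) < (p - 1) * N := by
  rw [div_lt_iff₀ (by linarith)] at h
  linarith

theorem exists_weight_exponent {N p : ℝ} (hN : 2 ≤ N) (hp2 : p < 2)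
    (h : (3 * N - 2) / (2 * N - 1) < p) :
    ∃ ξ : ℝ, 1 < ξ ∧ ξ < 2 ∧ (1 - ξ / 2) * (N / (N - 1)) = ξ * (2 - p) / (2 * (p - 1)) := by
  have hp := one_lt_of_lt_exponent hN h
  have hlt := two_sub_mul_lt hN h
  have h1 : 0 < (2 - p) * (N - 1) := mul_pos (by linarith) (by linarith)
  have h2 : 0 < (p - 1) * N := mul_pos (by linarith) (by linarith)
  have h3 : 0 < (p - 1) * N + (2 - p) * (N - 1) := by linarith
  have h4 : N - 1 ≠ 0 := by linarith
  have h5 : p - 1 ≠ 0 := by linarith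
  -- The matching condition is linear in ξ and this is its solution; ξ > 1 amounts to `hlt`, and ξ <
  -- 2 to `h1`.
  refine ⟨2 * ((p - 1) * N) / ((p - 1) * N + (2 - p) * (N - 1)), ?_, ?_, ?_⟩
  · rw [lt_div_iff₀ h3]; linarith
  · rw [div_lt_iff₀ h3]; linarith
  · have := h3.ne'
    field_simp
    ring

theorem integrable_norm_rpow_of_le_one {α E : Type*} [MeasurableSpace α] {μ : Measure α}
    [IsFiniteMeasure μ] [NormedAddCommGroup E] {f : α → E} (hf : Integrable f μ) {s : ℝ}
    (hs0 : 0 ≤ s) (hs1 : s ≤ 1) : Integrable (fun x => ‖f x‖ ^ s) μ := by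
  have h := integrable_rpow_mul_rpow hf.norm (integrable_const (1 : ℝ))
    (fun x => norm_nonneg _) (fun _ => zero_le_one) hs0 hs1
  simpa using h

/-! ### Comparison at a level -/

/-- The comparison estimate with an intermediate level `h`. -/
theorem exists_average_norm_sub_rpow_le {n : ℕ} (hn : 2 ≤ n) {p : ℝ}
    (hp₁ : (3 * (n : ℝ) - 2) / (2 * (n : ℝ) - 1) < p) (hp2 : p < 2) {Λ : ℝ} (hΛ : 0 < Λ) :
    ∃ C : ℝ, 0 ≤ C ∧ ∀ (A : Rn n → Rn n → Rn n) (Ω : Set (Rn n)) (μ : SignedMeasure (Rn n))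
      (u : Rn n → ℝ) (Du : Rn n → Rn n) (x₀ : Rn n) (R : ℝ) (w : Rn n → ℝ) (Dw : Rn n → Rn n)
      (h : ℝ), IsNonlinearity p Λ A → IsOpen Ω → MemW1pLoc p Ω u Du → SolvesIn A Ω Du μ →
      0 < R → Metric.closedBall x₀ (2 * R) ⊆ Ω →
      IsHomogeneousReplacement p A (Metric.ball x₀ (2 * R)) u Du w Dw → 0 < h →
      (μ.totalVariation (Metric.ball x₀ (2 * R))).toReal / R ^ (n - 1) ≤ h ^ (p - 1) →
      (μ.totalVariation (Metric.ball x₀ (2 * R))).toReal / R ^ (n - 1) *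
        (⨍ x in Metric.ball x₀ (2 * R), ‖Du x‖ ^ (2 - p)) ≤ h →
      ⨍ x in Metric.ball x₀ (2 * R), ‖Du x - Dw x‖ ^ (2 - p) ≤ C * h ^ (2 - p) := by
  have hn2 : (2 : ℝ) ≤ n := by exact_mod_cast hn
  have hp := one_lt_of_lt_exponent hn2 hp₁
  obtain ⟨ξ, hξ1, hξ2, hξ⟩ := exists_weight_exponent hn2 hp2 hp₁
  obtain ⟨S, k, hk0, hS, hS0, hSk, hS'⟩ := exists_bounded_primitive hξ1
  obtain ⟨Cs, hCs0, hCs⟩ := exists_average_weight_rpow_le hn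
  set Vone : ℝ := volume.real (Metric.ball (0 : Rn n) 1) with hVone
  have hVone0 : 0 < Vone := ENNReal.toReal_pos (Metric.measure_ball_pos _ _ one_pos).ne'
    Metric.isBounded_ball.measure_lt_top.ne
  set c₁ : ℝ := (3 * Λ) ^ (1 / p) + (3 * Λ) ^ (1 / 2 : ℝ) with hc₁
  have hc₁0 : 0 ≤ c₁ := by positivity
  set c₂ : ℝ := k / (2 ^ n * Vone) with hc₂
  have hc₂0 : 0 ≤ c₂ := by positivity
  -- One constant dominating those of monotonicity, the tested equation and Sobolev; the 2 is the
  -- additive term of the last.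
  set c : ℝ := c₁ + c₂ + Cs + 2 with hc
  obtain ⟨C, hC0, hC⟩ := exists_integral_rpow_le hp hp2 hn2 (c := c) (by positivity)
  refine ⟨C, hC0, ?_⟩
  intro A Ω μ u Du x₀ R w Dw h hA hΩ hu hsu hR hball ⟨hv, hsw⟩ hh hM1 hM2
  set B := Metric.ball x₀ (2 * R) with hB
  have hBt : volume B ≠ ⊤ := Metric.isBounded_ball.measure_lt_top.ne
  have : IsFiniteMeasure (volume.restrict B) := ⟨by simpa using hBt.lt_top⟩
  have hB0 : volume B ≠ 0 := (Metric.measure_ball_pos _ _ (by positivity)).ne'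
  have : NeZero (volume.restrict B) := ⟨by simpa [Measure.restrict_eq_zero] using hB0⟩
  set V := volume.real B with hV
  have hV0 : 0 < V := ENNReal.toReal_pos hB0 hBt
  have hVR : V = (2 * R) ^ n * Vone := volume_real_ball (by omega) _ (by positivity)
  have hBΩ : B ⊆ Ω := Metric.ball_subset_closedBall.trans hball
  set m := (μ.totalVariation B).toReal with hm
  have hm0 : 0 ≤ m := ENNReal.toReal_nonneg
  have hp' : (1 : ℝ≥0∞) ≤ ENNReal.ofReal p := by simpa using hp.le
  have hDu : MemLp Du (ENNReal.ofReal p) (volume.restrict B) :=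
    (hu.2 _ (isCompact_closedBall _ _) hball).2.mono_measure
      (Measure.restrict_mono Metric.ball_subset_closedBall le_rfl)
  have hDw : MemLp Dw (ENNReal.ofReal p) (volume.restrict B) := by
    have := hv.1.2.2.add hDu
    have e : ((fun x => Dw x - Du x) + Du) = Dw := by funext x; simp
    rwa [e] at this
  -- Scaling: `v` is measured in units of radius times gradient level, so R/H = h⁻¹.
  set H := R * h with hHdef
  have hH : 0 < H := by positivity
  set v : Rn n → ℝ := fun x => w x - u x with hvdef
  set W : Rn n → ℝ := fun x => √(1 + (H⁻¹ * v x) ^ 2) with hW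
  have hW1 : ∀ x, 1 ≤ W x := fun x => one_le_sqrt_one_add_sq _
  have hW0 : ∀ x, 0 < W x := fun x => zero_lt_one.trans_le (hW1 x)
  have hWm : AEMeasurable W (volume.restrict B) :=
    (((hv.1.2.1.1.aemeasurable.const_mul H⁻¹).pow_const 2).const_add 1).sqrt
  have hWξ : ∀ t : ℝ, √(1 + t ^ 2) ^ (-ξ) ≤ 1 := fun t =>
    Real.rpow_le_one_of_one_le_of_nonpos (one_le_sqrt_one_add_sq t) (by linarith)
  set g₀ : Rn n → ℝ := fun x => ⟪A x (Dw x) - A x (Du x), Dw x - Du x⟫ with hg₀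
  have hmono : ∀ᵐ x ∂volume.restrict B,
      Λ⁻¹ * ‖Dw x - Du x‖ ^ 2 * (‖Dw x‖ + ‖Du x‖) ^ (p - 2) ≤ g₀ x := by
    filter_upwards [ae_restrict_of_ae hA.continuous, ae_restrict_of_ae hA.differentiable,
      ae_restrict_of_ae hA.elliptic] with x h1 h2 h3
    exact strong_monotonicity hp2.le hΛ h1 h2 h3 _ _
  -- Monotonicity holds only almost everywhere, while the absorption lemma asks for nonnegativity
  -- everywhere; hence |g₀|.
  have hg₀0 : ∀ᵐ x ∂volume.restrict B, |g₀ x| = g₀ x := by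
    filter_upwards [hmono] with x hx
    exact abs_of_nonneg (le_trans (by positivity) hx)
  have hHol := holderTriple_ofReal hp
  have hg₀i : Integrable g₀ (volume.restrict B) :=
    integrable_inner_of_holderTriple ((hA.memLp hp hDw).sub (hA.memLp hp hDu)) hv.1.2.2
  -- the tested equation
  have htest : ∫ x in B, |g₀ x| * W x ^ (-ξ) ≤ H * k * m := by
    have hSH : ContDiff ℝ ∞ fun t => S (H⁻¹ * t) := hS.comp (by fun_prop)
    have hd : ∀ t, deriv (fun t => S (H⁻¹ * t)) t = H⁻¹ * √(1 + (H⁻¹ * t) ^ 2) ^ (-ξ) :=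
      fun t => by rw [deriv_comp_mul_left, smul_eq_mul, hS']
    have h1 := integral_deriv_comp_mul_inner_le hA hp hBt hΩ hBΩ hDu hDw hsu hsw hv hSH
      (by simpa using hS0) (fun t => hSk _) (c := H⁻¹) fun t => by
        rw [hd, abs_of_nonneg (by positivity)]
        exact mul_le_of_le_one_right (by positivity) (hWξ _)
    simp only [hd] at h1
    have h2 : ∫ x in B, |g₀ x| * W x ^ (-ξ) =
        H * ∫ x in B, H⁻¹ * √(1 + (H⁻¹ * v x) ^ 2) ^ (-ξ) * g₀ x := by
      rw [← integral_const_mul]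
      refine integral_congr_ae ?_
      filter_upwards [hg₀0] with x hx
      rw [hx]
      change g₀ x * W x ^ (-ξ) = H * (H⁻¹ * W x ^ (-ξ) * g₀ x)
      field_simp
    rw [h2]
    exact (mul_le_mul_of_nonneg_left h1 hH.le).trans_eq (mul_assoc _ _ _).symm
  obtain ⟨hWi, hWs⟩ := hCs p x₀ R H (1 - ξ / 2) v _ hp.le hR hH (by linarith) (by linarith) hv
  rw [hξ] at hWi hWs
  -- The normalised measure, whose integral is by definition the average over `B`.
  set ν : Measure (Rn n) := (volume.restrict B Set.univ)⁻¹ • volume.restrict B with hν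
  have hνtop : (volume.restrict B Set.univ)⁻¹ ≠ ⊤ := by simpa using hB0
  have hνi : ∀ {f : Rn n → ℝ}, Integrable f (volume.restrict B) → Integrable f ν :=
    fun hf => hf.smul_measure hνtop
  have hνae : ∀ {P : Rn n → Prop}, (∀ᵐ x ∂volume.restrict B, P x) → ∀ᵐ x ∂ν, P x :=
    fun hP => Measure.ae_smul_measure hP _
  have hgW : Integrable (fun x => |g₀ x| * W x ^ (-ξ)) (volume.restrict B) := by
    refine hg₀i.norm.mono' (hg₀i.norm.aemeasurable.mul
      (hWm.pow_const _)).aestronglyMeasurable (.of_forall fun x => ?_)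
    rw [Real.norm_of_nonneg (mul_nonneg (abs_nonneg _) (Real.rpow_nonneg (hW0 x).le _))]
    exact mul_le_of_le_one_right (abs_nonneg _) (hWξ _)
  refine hC (Rn n) ν (fun x => |g₀ x|) (fun x => ‖Du x‖) (fun x => ‖Du x - Dw x‖) W ξ _ h
    (m / R ^ (n - 1)) (by linarith) rfl hh (by positivity) (fun x => abs_nonneg _)
    (fun x => norm_nonneg _) (fun x => norm_nonneg _) hW1 (hνi hgW)
    (hνi (integrable_norm_rpow_of_le_one (hDu.integrable hp') (by linarith) (by linarith)))
    (hνi hWi) (hνae ?_) ?_ ?_ hM1 hM2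
  · filter_upwards [hmono, hg₀0] with x h1 h2
    rw [norm_sub_rev (Dw x), add_comm ‖Dw x‖] at h1
    have hg₀x : 0 ≤ g₀ x := by rw [← h2]; exact abs_nonneg _
    rw [h2]
    refine (le_rpow_add_rpow_of_mul_sq_le hp hp2 hΛ (norm_nonneg _) (norm_nonneg _)
      (norm_sub_le _ _) ?_ hg₀x h1).trans ?_
    · exact norm_le_norm_add_norm_sub _ _
    · refine mul_le_mul_of_nonneg_right ?_ (by positivity)
      linarith
  · change ⨍ x in B, |g₀ x| * W x ^ (-ξ) ≤ _
    rw [setAverage_eq, smul_eq_mul]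
    calc V⁻¹ * ∫ x in B, |g₀ x| * W x ^ (-ξ) ≤ V⁻¹ * (H * k * m) := by gcongr
      _ = c₂ * (h * (m / R ^ (n - 1))) := by
        have hRn : R ^ n = R * R ^ (n - 1) := by
          rw [← pow_succ']; congr 1; omega
        rw [hVR, hc₂, hHdef, mul_pow, hRn]
        field_simp
      _ ≤ c * (h * (m / R ^ (n - 1))) := by
        refine mul_le_mul_of_nonneg_right ?_ (by positivity)
        linarith
  · have e1 : R / H = h⁻¹ := by rw [hHdef]; field_simp
    have e2 : 1 - ξ / 2 - 1 = -ξ / 2 := by ring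
    rw [e1, e2] at hWs
    simp_rw [norm_sub_rev (Dw _)] at hWs
    refine hWs.trans (add_le_add (mul_le_mul_of_nonneg_right (by linarith) ?_) (by linarith))
    refine mul_nonneg (by positivity) (integral_nonneg fun x => ?_)
    exact mul_nonneg (Real.rpow_nonneg (Real.sqrt_nonneg _) _) (norm_nonneg _)

/-! ### Young's inequality and the conclusion -/

/-- Young's inequality in the form `C x y ≤ C_ε x^{1/(p-1)} + ε y^{1/(2-p)}`. -/
theorem mul_mul_le_of_young {p C ε x y : ℝ} (hp : 1 < p) (hp2 : p < 2) (hC : 0 ≤ C) (hε : 0 < ε)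
    (hx : 0 ≤ x) (hy : 0 ≤ y) :
    C * x * y ≤ (C / ε ^ (2 - p)) ^ (1 / (p - 1)) * x ^ (1 / (p - 1)) +
      ε * y ^ (1 / (2 - p)) := by
  have hp1 : 0 < p - 1 := by linarith
  have hp3 : 0 < 2 - p := by linarith
  -- Chosen so that δ^(1/(2-p)) = ε.
  set δ := ε ^ (2 - p) with hδ
  have hδ0 : 0 < δ := by positivity
  have h := Real.geom_mean_le_arith_mean2_weighted hp1.le hp3.le
    (Real.rpow_nonneg (show 0 ≤ C / δ * x by positivity) (1 / (p - 1)))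
    (Real.rpow_nonneg (show 0 ≤ δ * y by positivity) (1 / (2 - p))) (by ring)
  rw [← Real.rpow_mul (by positivity), ← Real.rpow_mul (by positivity),
    one_div_mul_cancel hp1.ne', one_div_mul_cancel hp3.ne', Real.rpow_one, Real.rpow_one] at h
  have e : C / δ * x * (δ * y) = C * x * y := by field_simp
  have e1 : (δ * y) ^ (1 / (2 - p)) = ε * y ^ (1 / (2 - p)) := by
    rw [Real.mul_rpow hδ0.le hy, hδ, ← Real.rpow_mul hε.le, mul_one_div_cancel hp3.ne',
      Real.rpow_one]
  rw [e, e1, Real.mul_rpow (by positivity) hx] at h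
  refine h.trans (add_le_add (mul_le_of_le_one_left (by positivity) (by linarith))
    (mul_le_of_le_one_left (by positivity) (by linarith)))

end SingularMeasureData

theorem lemma2p2 (n : ℕ) (hn : 2 ≤ n) (p : ℝ)
    (hp₁ : (3 * (n : ℝ) - 2) / (2 * (n : ℝ) - 1) < p) (hp₂ : p ≤ 2 - 1 / (n : ℝ)) :
    ∃ γ₀ : ℝ, (2 - p) / 2 ≤ γ₀ ∧ γ₀ < (p - 1) * (n : ℝ) / ((n : ℝ) - 1) ∧
      (p - 1) * (n : ℝ) / ((n : ℝ) - 1) ≤ 1 ∧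
      ∀ Λ : ℝ, 0 < Λ →
        ∃ C : ℝ, 0 < C ∧ ∃ Cε : ℝ → ℝ, (∀ ε : ℝ, 0 < ε → 0 < Cε ε) ∧
          ∀ (A : SingularMeasureData.Rn n → SingularMeasureData.Rn n → SingularMeasureData.Rn n)
            (Ω : Set (SingularMeasureData.Rn n))
            (μ : SignedMeasure (SingularMeasureData.Rn n))
            (u : SingularMeasureData.Rn n → ℝ)
            (Du : SingularMeasureData.Rn n → SingularMeasureData.Rn n)
            (x₀ : SingularMeasureData.Rn n) (R : ℝ)
            (w : SingularMeasureData.Rn n → ℝ)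
            (Dw : SingularMeasureData.Rn n → SingularMeasureData.Rn n),
            SingularMeasureData.IsNonlinearity p Λ A →
            IsOpen Ω → Bornology.IsBounded Ω →
            SingularMeasureData.MemW1pLoc p Ω u Du →
            SingularMeasureData.SolvesIn A Ω Du μ →
            0 < R → Metric.closedBall x₀ (2 * R) ⊆ Ω →
            SingularMeasureData.IsHomogeneousReplacement p A (Metric.ball x₀ (2 * R)) u Du w Dw →
            (⨍ x in Metric.ball x₀ (2 * R), ‖Du x - Dw x‖ ^ γ₀) ^ (1 / γ₀) ≤
                C * ((μ.totalVariation (Metric.ball x₀ (2 * R))).toReal / R ^ (n - 1)) ^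
                    (1 / (p - 1)) +
                C * ((μ.totalVariation (Metric.ball x₀ (2 * R))).toReal / R ^ (n - 1)) *
                  (⨍ x in Metric.ball x₀ (2 * R), ‖Du x‖ ^ γ₀) ^ ((2 - p) / γ₀) ∧
            ∀ ε : ℝ, 0 < ε →
              (⨍ x in Metric.ball x₀ (2 * R), ‖Du x - Dw x‖ ^ γ₀) ^ (1 / γ₀) ≤
                Cε ε * ((μ.totalVariation (Metric.ball x₀ (2 * R))).toReal / R ^ (n - 1)) ^
                    (1 / (p - 1)) +
                ε * (⨍ x in Metric.ball x₀ (2 * R), ‖Du x‖ ^ γ₀) ^ (1 / γ₀) := by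
  have hn2 : (2 : ℝ) ≤ n := by exact_mod_cast hn
  have hn0 : (0 : ℝ) < n := by linarith
  have hp : 1 < p := SingularMeasureData.one_lt_of_lt_exponent hn2 hp₁
  have hp2 : p < 2 := hp₂.trans_lt (by linarith [one_div_pos.2 hn0])
  have hp1 : 0 < p - 1 := by linarith
  have hp3 : 0 < 2 - p := by linarith
  -- With γ₀ = 2 - p the exponent (2-p)/γ₀ is 1.
  refine ⟨2 - p, by linarith, ?_, ?_, ?_⟩
  · rw [lt_div_iff₀ (by linarith)]
    exact SingularMeasureData.two_sub_mul_lt hn2 hp₁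
  · rw [div_le_one (by linarith)]
    have h1 := mul_le_mul_of_nonneg_right hp₂ hn0.le
    have h2 : (2 - 1 / (n : ℝ)) * n = 2 * n - 1 := by field_simp
    linarith
  intro Λ hΛ
  obtain ⟨C₀, hC₀, hmain⟩ :=
    SingularMeasureData.exists_average_norm_sub_rpow_le hn hp₁ hp2 hΛ
  -- The 1 makes `C` positive even if `C₀ = 0`.
  set C : ℝ := C₀ ^ (1 / (2 - p)) + 1 with hCdef
  have hC : 0 < C := by positivity
  refine ⟨C, hC, fun ε => C + (C / ε ^ (2 - p)) ^ (1 / (p - 1)), fun ε hε => by positivity, ?_⟩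
  intro A Ω μ u Du x₀ R w Dw hA hΩ _ hu hsu hR hball hrep
  set M : ℝ := (μ.totalVariation (Metric.ball x₀ (2 * R))).toReal / R ^ (n - 1) with hM
  have hM0 : 0 ≤ M := by positivity
  set Q : ℝ := ⨍ x in Metric.ball x₀ (2 * R), ‖Du x‖ ^ (2 - p) with hQ
  have hQ0 : 0 ≤ Q := integral_nonneg fun x => by positivity
  set I : ℝ := ⨍ x in Metric.ball x₀ (2 * R), ‖Du x - Dw x‖ ^ (2 - p) with hI
  have hI0 : 0 ≤ I := integral_nonneg fun x => by positivity
  have hMp : 0 ≤ M ^ (1 / (p - 1)) := by positivity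
  have hMQ : 0 ≤ M * Q := by positivity
  have key : I ^ (1 / (2 - p)) ≤ C * M ^ (1 / (p - 1)) + C * M * Q := by
    refine le_of_forall_pos_le_add fun δ hδ => ?_
    -- The term δ/C keeps h positive when |μ|(B) = 0, and costs exactly δ after multiplication by
    -- `C`.
    set h := M ^ (1 / (p - 1)) + M * Q + δ / C with hh
    have hδC : 0 < δ / C := by positivity
    have hh0 : 0 < h := by positivity
    have h1 : M ≤ h ^ (p - 1) := by
      calc M = (M ^ (1 / (p - 1))) ^ (p - 1) := by
            rw [← Real.rpow_mul hM0, one_div_mul_cancel hp1.ne', Real.rpow_one]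
        _ ≤ h ^ (p - 1) := Real.rpow_le_rpow hMp (by linarith) hp1.le
    have h2 := hmain A Ω μ u Du x₀ R w Dw h hA hΩ hu hsu hR hball hrep hh0 h1 (by linarith)
    calc I ^ (1 / (2 - p)) ≤ (C₀ * h ^ (2 - p)) ^ (1 / (2 - p)) :=
          Real.rpow_le_rpow hI0 h2 (by positivity)
      _ = C₀ ^ (1 / (2 - p)) * h := by
          rw [Real.mul_rpow hC₀ (by positivity), ← Real.rpow_mul hh0.le,
            mul_one_div_cancel hp3.ne', Real.rpow_one]
      _ ≤ C * h := mul_le_mul_of_nonneg_right (by linarith) hh0.le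
      _ = _ := by rw [hh]; field_simp
  refine ⟨?_, fun ε hε => ?_⟩
  · rwa [div_self hp3.ne', Real.rpow_one]
  · have hy := SingularMeasureData.mul_mul_le_of_young hp hp2 hC.le hε hM0 hQ0
    linarith
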